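/- A graph is a finite CW complex of dimension at most $1$. The minimal simplicial model of a graph $Y$ is a finite simple graph $H$ whose geometric realization is homeomorphic to $Y$ and in which the two neighbours of every bivalent vertex are adjacent (so that no smoothing of a bivalent vertex is simplicial); it is unique up to isomorphism. A graph is triconnected if its minimal simplicial model has at least two vertices and any two distinct vertices of it are joined by three distinct paths that are pairwise disjoint away from their endpoints. An angel is a graph $\Omega$ that consists of an edge $e$ with endpoints $v\neq v'$; a loop $S$ (a circle disjoint from $e$ and its endpoints) carrying points $x_1,y_1,y_2,x_2$, which occur along $S$ in this cyclic order, where $x_1=y_1$ and $x_2=y_2$ are allowed but points with different indices are distinct; and, for $i=1,2$, an edge from $v$ to $x_i$ and an edge from $y_i$ to $v'$. A split angel is an angel together with an additional edge connecting two distinct components of $S\setminus\{x_1,y_1,x_2,y_2\}$. An angelic graph is a topological embedding $\Omega\to\Gamma$ of an angel in a graph; parts of $\Omega$ are identified with their images in $\Gamma$. It is split if the embedding extends to an embedding of a split angel. Two angelic graphs $\Omega_1\to\Gamma$ and $\Omega_2\to\Gamma$ are equivalent if they agree on the (parametrized) edge $e$ and on the (parametrized) loop $S$. Proposition 7.4.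 Let $\Omega\to\Gamma$ be an angelic graph such that 1. $\Gamma$ is planar, i.e. embeds topologically in $\mathbb{R}^2$; 2. $\Gamma\setminus e$ (the complement of the open edge $e$) is triconnected; and 3. $v$ and $v'$ lie in distinct components of $\Gamma\setminus(e\cup S)$, where $e$ again denotes the open edge. Then there is an angelic graph $\Omega'\to\Gamma$ that is equivalent to the given one and is split. -/

import Mathlib

/-! Graphs are finite CW complexes of dimension at most one (Mathlib's `Topology.CWComplex`), and
are treated as topological spaces. -/

/-- The geometric realization of a simple graph `H`: the union, in `W → ℝ`, of its vertices (the
standard basis vectors) and of the segments joining adjacent vertices. For finite `W` these are the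
finite one-dimensional simplicial complexes. -/
def graphRealization {W : Type*} [DecidableEq W] (H : SimpleGraph W) : Set (W → ℝ) :=
  {p | ∃ a b : W, (a = b ∨ H.Adj a b) ∧
    p ∈ segment ℝ (Pi.single a (1 : ℝ)) (Pi.single b (1 : ℝ))}

/-- `H` is a minimal simplicial model of the space `Y`: the realization of `H` is homeomorphic to
`Y`, and no nontrivial smoothing of `H` is simplicial. Smoothing a bivalent vertex `w` with
neighbours `a ≠ b` yields a simplicial graph exactly when `a` and `b` are not adjacent. -/
def IsMinimalSimplicialModel {W : Type*} [DecidableEq W] (H : SimpleGraph W)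
    (Y : Type*) [TopologicalSpace Y] : Prop :=
  Nonempty (graphRealization H ≃ₜ Y) ∧
    ∀ w a b : W, a ≠ b → H.neighborSet w = {a, b} → H.Adj a b

/-- There are `k` different paths from `x` to `y` in `H` which are pairwise disjoint away from
their endpoints. -/
def HasDisjointPaths {W : Type*} (H : SimpleGraph W) (k : ℕ) (x y : W) : Prop :=
  ∃ γ : Fin k → H.Path x y, Function.Injective γ ∧
    ∀ i j, i ≠ j → ∀ z, z ∈ (γ i).1.support → z ∈ (γ j).1.support → z = x ∨ z = y

/-- Topological `k`-connectedness (for `k ≥ 1`) of a space that is a finite graph: any two distinct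
vertices of the minimal simplicial model are joined by `k` paths that are pairwise disjoint away
from the endpoints. The singleton is `1`-connected, but not `k`-connected for `k > 1`. -/
def IsTopKConnected (k : ℕ) (Y : Type*) [TopologicalSpace Y] : Prop :=
  ∃ (n : ℕ) (H : SimpleGraph (Fin n)), IsMinimalSimplicialModel H Y ∧
    (1 < n ∨ (n = 1 ∧ k ≤ 1)) ∧ ∀ x y : Fin n, x ≠ y → HasDisjointPaths H k x y

/-- A space is planar if it embeds in the Euclidean plane. -/
def IsPlanarSpace (X : Type*) [TopologicalSpace X] : Prop :=
  ∃ f : X → EuclideanSpace ℝ (Fin 2), Topology.IsEmbedding f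

/-- A topological embedding of an angel in the Hausdorff space `X`, given by its restrictions to
the pieces of the angel.

The angel consists of an edge `e` from `v = e 0` to `v' = e 1`, a loop `S`, and, for each of the two
values of `i`, a leg `α i` from `v` to the point `x i` of `S` and a leg `β i` from the point `y i`
of `S` to `v'`. The points `x i`, `y i` are recorded by real parameters along the loop, which is
parametrized by `ℝ / ℤ`; they occur in the cyclic order `x 0, y 0, y 1, x 1` along `S`, where
`x i = y i` is allowed, while points with different indices are distinct. The angel's path `γ i`
from `v` to `v'` is `α i`, then the arc of `S` from `x i` to `y i` that avoids the other two points,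
then `β i`.

The pieces are compact, so an injective continuous map on the angel is an embedding; the axioms
say that all pieces are embedded and that they meet in the prescribed points only. -/
structure AngelicGraph (X : Type*) [TopologicalSpace X] where
  e : C(unitInterval, X)
  S : C(AddCircle (1 : ℝ), X)
  x : Fin 2 → ℝ
  y : Fin 2 → ℝ
  α : Fin 2 → C(unitInterval, X)
  β : Fin 2 → C(unitInterval, X)
  order_zero : x 0 ≤ y 0
  order_mid : y 0 < y 1
  order_one : y 1 ≤ x 1
  order_turn : x 1 < x 0 + 1
  e_injective : Function.Injective e
  S_injective : Function.Injective S
  α_injective : ∀ i, Function.Injective (α i)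
  β_injective : ∀ i, Function.Injective (β i)
  α_source : ∀ i, α i 0 = e 0
  α_target : ∀ i, α i 1 = S (x i : AddCircle (1 : ℝ))
  β_source : ∀ i, β i 0 = S (y i : AddCircle (1 : ℝ))
  β_target : ∀ i, β i 1 = e 1
  e_S : ∀ s t, e s ≠ S t
  α_e : ∀ i s t, α i s = e t → s = 0
  β_e : ∀ i s t, β i s = e t → s = 1
  α_S : ∀ i s t, α i s = S t → s = 1
  β_S : ∀ i s t, β i s = S t → s = 0
  α_α : ∀ s t, α 0 s = α 1 t → s = 0 ∧ t = 0
  β_β : ∀ s t, β 0 s = β 1 t → s = 1 ∧ t = 1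
  α_β : ∀ i j s t, α i s = β j t → s = 1 ∧ t = 0

namespace AngelicGraph

variable {X : Type*} [TopologicalSpace X]

/-- The vertex `v`. -/
def v (A : AngelicGraph X) : X := A.e 0

/-- The vertex `v'`. -/
def v' (A : AngelicGraph X) : X := A.e 1

/-- The open edge `e`. -/
def openEdge (A : AngelicGraph X) : Set X := A.e '' Set.Ioo 0 1

/-- The loop `S` as a subset of `X`. -/
def loop (A : AngelicGraph X) : Set X := Set.range A.S

/-- The image of the whole angel. -/
def support (A : AngelicGraph X) : Set X :=
  Set.range A.e ∪ Set.range A.S ∪ (⋃ i, Set.range (A.α i)) ∪ ⋃ i, Set.range (A.β i)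

/-- The loop with the points `x 0`, `y 0`, `x 1`, `y 1` removed, seen in the parameter circle. -/
def loopComplement (A : AngelicGraph X) : Set (AddCircle (1 : ℝ)) :=
  {s | ∀ i, s ≠ (A.x i : AddCircle (1 : ℝ)) ∧ s ≠ (A.y i : AddCircle (1 : ℝ))}

/-- Two angelic graphs in `X` are equivalent if they agree on the edge `e` and on the loop `S`. -/
def Equivalent (A B : AngelicGraph X) : Prop := A.e = B.e ∧ A.S = B.S

/-- The angelic graph is split: it extends to an embedding of a split angel. The additional edge is
an embedded arc `d`, whose endpoints lie in distinct components of `S \ {x 0, y 0, x 1, y 1}` and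
whose interior is disjoint from the angel. -/
def IsSplit (A : AngelicGraph X) : Prop :=
  ∃ (d : C(unitInterval, X)) (s t : AddCircle (1 : ℝ)),
    Function.Injective d ∧ d 0 = A.S s ∧ d 1 = A.S t ∧
    s ∈ A.loopComplement ∧ t ∈ A.loopComplement ∧ t ∉ connectedComponentIn A.loopComplement s ∧
    ∀ r, r ≠ 0 → r ≠ 1 → d r ∉ A.support

end AngelicGraph

/-! ### Weak drawings of `K₃,₃` and `K₅` in the plane -/

/-! Let C and C' be the components of Γ ∖ (e ∪ S) containing v and v'. Call a point of S a foot of a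
component if an arc leads from it into that component (`Attaches`).

Planarity enters only through the absence of drawings of K₃,₃ and K₅ in which independent edges are
disjoint. For disjoint paths A and B the difference A s - B t has a continuous logarithm over a
square. This gives one integer identity per pair of independent edges (`turns_cell`), and the sum of
these identities is impossible modulo four. No Jordan curve theorem is needed.

Since e joins C to C' off the loop, K₃,₃ shows that the feet of C and C' do not cross on S, and K₅
shows that they have at most two common points (`not_crossing_of_joinedIn`, `not_three_common`).
Hence there are feet X₀, X₁ of C and Y₀, Y₁ of C' with X₀ ≤ Y₀ < Y₁ ≤ X₁ < X₀ + 1, such that C has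
no foot strictly between X₀ and X₁ and C' has none strictly between Y₁ and Y₀ + 1
(`exists_extremal`). The legs of the angel can be rerouted to these feet (`exists_fan`): the only
obstruction is a tripod, which again produces a K₃,₃ (`not_tripod`).

The new angel is split. For p in {X₀, Y₀} and q in {X₁, Y₁}, the components C and C' attach on
opposite sides of the pair p, q. This pair does not separate the triconnected graph Γ ∖ e, so some
component has feet strictly on both sides (`exists_bridge`). It is neither C nor C', so it avoids
the angel, and it supplies a splitting edge unless one of the two feet is a special point. If none
of the bridges obtained from the four pairs splits the angel, then two of them together with C ∪ e ∪
C' form a K₃,₃ (`bridges_contradiction`, `not_three_bridges`).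

The passage between topology and combinatorics rests on `inner_subset_or_disjoint`: the loop is a
union of edges of the simplicial model. Consequently components of its complement are arc connected
and their feet are vertices. -/

theorem exists_continuous_log {A : Type*} [TopologicalSpace A] [SimplyConnectedSpace A]
    [LocallyPathConnectedSpace A] [Nonempty A] {f : A → ℂ} (hf : Continuous f)
    (h0 : ∀ x, f x ≠ 0) : ∃ g : A → ℂ, Continuous g ∧ ∀ x, Complex.exp (g x) = f x := by
  obtain ⟨a⟩ := ‹Nonempty A›
  obtain ⟨g, ⟨-, hg⟩, -⟩ := Complex.isCoveringMapOn_exp.existsUnique_continuousMap_lifts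
    ⟨f, hf⟩ (a₀ := a) (Complex.exp_log (h0 a)) (fun x => h0 x)
  exact ⟨g, g.continuous, fun x => congr_fun hg x⟩

/-- The function h and the constant h s both lift the constant c through the covering exp and agree
at s, so they coincide. -/
theorem eq_of_exp_eq_const {h : ℝ → ℂ} (hh : Continuous h) {c : ℂ}
    (hc : ∀ t, Complex.exp (h t) = c) (s t : ℝ) : h s = h t := by
  have h0 : c ≠ 0 := by rw [← hc 0]; exact Complex.exp_ne_zero _
  obtain ⟨g, -, hg⟩ := Complex.isCoveringMapOn_exp.existsUnique_continuousMap_lifts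
    ⟨fun _ : ℝ => c, continuous_const⟩ (a₀ := s) (hc s) (fun _ => h0)
  have h1 := hg ⟨h, hh⟩ ⟨rfl, funext fun x => hc x⟩
  have h2 := hg ⟨fun _ => h s, continuous_const⟩ ⟨rfl, funext fun x => hc s⟩
  have := congr_arg (fun F : C(ℝ, ℂ) => F t) (h1.trans h2.symm)
  exact this.symm

open Classical in
/-- The change of the logarithm of `A t - z` for `t` from `0` to `1`. -/
noncomputable def logChange (A : ℝ → ℂ) (z : ℂ) : ℂ :=
  if h : ∃ g : ℝ → ℂ, Continuous g ∧ ∀ t, Complex.exp (g t) = A t - z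
  then h.choose 1 - h.choose 0 else 0

/-- Two logarithms of one function differ by a constant, so any of them may be used. The factor c
absorbs a sign: a logarithm of A s - B t is, for fixed s, a logarithm of -(B t - A s). -/
theorem logChange_eq {A : ℝ → ℂ} {z c : ℂ} {g : ℝ → ℂ} (hg : Continuous g) (hc : c ≠ 0)
    (hgA : ∀ t, Complex.exp (g t) = c * (A t - z)) : logChange A z = g 1 - g 0 := by
  have h : ∃ g : ℝ → ℂ, Continuous g ∧ ∀ t, Complex.exp (g t) = A t - z :=
    ⟨fun t => g t - Complex.log c, by fun_prop, fun t => by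
      rw [Complex.exp_sub, Complex.exp_log hc, hgA]; field_simp⟩
  rw [logChange, dif_pos h]
  obtain ⟨h1, h2⟩ := h.choose_spec
  have key := eq_of_exp_eq_const (h := fun t => g t - h.choose t) (by fun_prop) (c := c)
    (fun t => by
      have := Complex.exp_ne_zero (h.choose t)
      rw [Complex.exp_sub, hgA, ← h2, mul_div_assoc, div_self this, mul_one]) 1 0
  linear_combination -key

/-- The difference A s - B t has a logarithm g on all of ℝ × ℝ, which is simply connected. Both
sides equal g (1, 1) - g (0, 0), computed along the two boundary paths of the unit square. -/
theorem logChange_cell {A B : ℝ → ℂ} (hA : Continuous A) (hB : Continuous B)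
    (hAB : ∀ s t, A s ≠ B t) :
    logChange A (B 0) + logChange B (A 1) = logChange B (A 0) + logChange A (B 1) := by
  obtain ⟨g, hg, hgA⟩ := exists_continuous_log (A := ℝ × ℝ) (f := fun x => A x.1 - B x.2)
    (by fun_prop) (fun x => sub_ne_zero.2 (hAB _ _))
  have h1 : logChange A (B 0) = g (1, 0) - g (0, 0) :=
    logChange_eq (g := fun s => g (s, 0)) (c := 1) (by fun_prop) one_ne_zero (by simp [hgA])
  have h2 : logChange A (B 1) = g (1, 1) - g (0, 1) :=
    logChange_eq (g := fun s => g (s, 1)) (c := 1) (by fun_prop) one_ne_zero (by simp [hgA])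
  have h3 : logChange B (A 0) = g (0, 1) - g (0, 0) :=
    logChange_eq (g := fun s => g (0, s)) (c := -1) (by fun_prop) (by simp) (by simp [hgA])
  have h4 : logChange B (A 1) = g (1, 1) - g (1, 0) :=
    logChange_eq (g := fun s => g (1, s)) (c := -1) (by fun_prop) (by simp) (by simp [hgA])
  rw [h1, h2, h3, h4]
  ring

/-- Logarithms of `P j - P i`, chosen such that those of opposite differences differ by `π i`. -/
noncomputable def pairLog {ι : Type*} [LinearOrder ι] (P : ι → ℂ) (i j : ι) : ℂ :=
  if i < j then Complex.log (P j - P i) else Complex.log (P i - P j) + Real.pi * Complex.I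

theorem exp_pairLog {ι : Type*} [LinearOrder ι] {P : ι → ℂ} {i j : ι} (h : P i ≠ P j) :
    Complex.exp (pairLog P i j) = P j - P i := by
  unfold pairLog
  split_ifs
  · exact Complex.exp_log (sub_ne_zero.2 h.symm)
  · rw [Complex.exp_add, Complex.exp_log (sub_ne_zero.2 h), Complex.exp_pi_mul_I]; ring

/-- The sign of a pair of indices. -/
def pairSign {ι : Type*} [LinearOrder ι] (i j : ι) : ℤ := if i < j then -1 else 1

theorem pairLog_sub {ι : Type*} [LinearOrder ι] {P : ι → ℂ} {i j : ι} (h : i ≠ j) :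
    pairLog P i j - pairLog P j i = pairSign i j * (Real.pi * Complex.I) := by
  unfold pairLog pairSign
  rcases lt_or_gt_of_ne h with h | h
  · simp [h, h.not_gt]
  · simp [h, h.not_gt]

open Classical in
/-- The number of turns of the path `A` from `P a` to `P b` around `P k`. -/
noncomputable def turns {ι : Type*} [LinearOrder ι] (P : ι → ℂ) (A : ℝ → ℂ) (k a b : ι) : ℤ :=
  if h : ∃ n : ℤ, logChange A (P k) = pairLog P k b - pairLog P k a + n * (2 * Real.pi * Complex.I)
  then h.choose else 0

theorem logChange_eq_turns {ι : Type*} [LinearOrder ι] {P : ι → ℂ} {A : ℝ → ℂ} {k a b : ι}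
    (hA : Continuous A) (h0 : A 0 = P a) (h1 : A 1 = P b) (hk : ∀ t, A t ≠ P k) :
    logChange A (P k) = pairLog P k b - pairLog P k a + turns P A k a b * (2 * Real.pi * Complex.I)
    := by
  have h : ∃ n : ℤ, logChange A (P k) =
      pairLog P k b - pairLog P k a + n * (2 * Real.pi * Complex.I) := by
    obtain ⟨g, hg, hgA⟩ := exists_continuous_log (f := fun t => A t - P k) (by fun_prop)
      (fun t => sub_ne_zero.2 (hk t))
    have ha : P k ≠ P a := fun h => hk 0 (by rw [h0, h])
    have hb : P k ≠ P b := fun h => hk 1 (by rw [h1, h])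
    obtain ⟨n, hn⟩ := Complex.exp_eq_exp_iff_exists_int.1
      (show Complex.exp (logChange A (P k)) = Complex.exp (pairLog P k b - pairLog P k a) by
        rw [logChange_eq hg one_ne_zero (by simpa using hgA), Complex.exp_sub, Complex.exp_sub, hgA,
          hgA, exp_pairLog ha, exp_pairLog hb, h0, h1])
    exact ⟨n, by rw [hn]⟩
  rw [turns, dif_pos h]
  exact h.choose_spec

/-- This is the cell identity divided by πi. The logarithms of the differences of endpoints occur in
opposite pairs, so that of each pair only a half turn remains, with the sign recorded by `pairSign`.
-/
theorem turns_cell {ι : Type*} [LinearOrder ι] {P : ι → ℂ} {A B : ℝ → ℂ} {a b c d : ι}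
    (hA : Continuous A) (hB : Continuous B) (hAB : ∀ s t, A s ≠ B t)
    (hA0 : A 0 = P a) (hA1 : A 1 = P b) (hB0 : B 0 = P c) (hB1 : B 1 = P d) :
    pairSign c b + pairSign a c + pairSign b d + pairSign d a
      + 2 * (turns P A c a b + turns P B b c d - turns P B a c d - turns P A d a b) = 0 := by
  have key := logChange_cell hA hB hAB
  have hac : a ≠ c := by rintro rfl; exact hAB 0 0 (by rw [hA0, hB0])
  have had : a ≠ d := by rintro rfl; exact hAB 0 1 (by rw [hA0, hB1])
  have hbc : b ≠ c := by rintro rfl; exact hAB 1 0 (by rw [hA1, hB0])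
  have hbd : b ≠ d := by rintro rfl; exact hAB 1 1 (by rw [hA1, hB1])
  rw [hA0, hA1, hB0, hB1,
    logChange_eq_turns hA hA0 hA1 (fun t => hB0 ▸ hAB t 0),
    logChange_eq_turns hA hA0 hA1 (fun t => hB1 ▸ hAB t 1),
    logChange_eq_turns hB hB0 hB1 (fun t h => hAB 0 t (hA0.trans h.symm)),
    logChange_eq_turns hB hB0 hB1 (fun t h => hAB 1 t (hA1.trans h.symm))] at key
  have h1 := pairLog_sub (P := P) hac
  have h2 := pairLog_sub (P := P) had.symm
  have h3 := pairLog_sub (P := P) hbc.symm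
  have h4 := pairLog_sub (P := P) hbd
  have hpi : (Real.pi * Complex.I : ℂ) ≠ 0 := by simp [Real.pi_ne_zero]
  have : ((pairSign c b + pairSign a c + pairSign b d + pairSign d a
      + 2 * (turns P A c a b + turns P B b c d - turns P B a c d - turns P A d a b) : ℤ) : ℂ)
      * (Real.pi * Complex.I) = 0 := by
    push_cast
    linear_combination key - h1 - h2 - h3 - h4
  exact_mod_cast (mul_eq_zero.1 this).resolve_right hpi

/-- There is no drawing of `K₃,₃` in the plane in which independent edges are disjoint. -/
theorem not_drawing_K33 {X : Type*} [TopologicalSpace X] {f : X → ℂ} (hf : Continuous f)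
    (hinj : Function.Injective f) (a b : Fin 3 → X) (F : Fin 3 → Fin 3 → Set X)
    (hJ : ∀ i j, JoinedIn (F i j) (a i) (b j))
    (hD : ∀ i i' j j', i < i' → j ≠ j' → Disjoint (F i j) (F i' j')) : False := by
  let P : Fin 6 → ℂ := ![f (a 0), f (a 1), f (a 2), f (b 0), f (b 1), f (b 2)]
  -- Extended constantly to ℝ, the paths stay in the sets F i j, so they are disjoint for all real
  -- parameters, as the cell identity demands.
  let γ : Fin 3 → Fin 3 → ℝ → ℂ := fun i j t => f ((hJ i j).somePath.extend t)
  have hc : ∀ i j, Continuous (γ i j) := fun i j => hf.comp (hJ i j).somePath.continuous_extend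
  have h0 : ∀ i j, γ i j 0 = f (a i) := fun i j => by simp [γ]
  have h1 : ∀ i j, γ i j 1 = f (b j) := fun i j => by simp [γ]
  have hm : ∀ i j t, (hJ i j).somePath.extend t ∈ F i j := fun i j t => by
    simp only [Path.extend, Set.IccExtend]
    exact (hJ i j).somePath_mem _
  have hne : ∀ i i' j j', i < i' → j ≠ j' → ∀ s t, γ i j s ≠ γ i' j' t := by
    intro i i' j j' hi hj s t h
    exact Set.disjoint_left.1 (hD i i' j j' hi hj) (hm i j s) (hinj h ▸ hm i' j' t)
  have e := fun (i i' j j' : Fin 3) (hi : i < i') (hj : j ≠ j') (x y z w : Fin 6)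
    (hx : P x = f (a i)) (hy : P y = f (b j)) (hz : P z = f (a i')) (hw : P w = f (b j')) =>
    turns_cell (P := P) (a := x) (b := y) (c := z) (d := w) (hc i j) (hc i' j') (hne i i' j j' hi hj)
      ((h0 i j).trans hx.symm) ((h1 i j).trans hy.symm) ((h0 i' j').trans hz.symm)
      ((h1 i' j').trans hw.symm)
  have s01 : (0 : Fin 3) < 1 := by decide
  have s02 : (0 : Fin 3) < 2 := by decide
  have s12 : (1 : Fin 3) < 2 := by decide
  have e1 := e 0 1 0 1 s01 (by decide) 0 3 1 4 rfl rfl rfl rfl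
  have e2 := e 0 1 0 2 s01 (by decide) 0 3 1 5 rfl rfl rfl rfl
  have e3 := e 0 1 1 0 s01 (by decide) 0 4 1 3 rfl rfl rfl rfl
  have e4 := e 0 1 1 2 s01 (by decide) 0 4 1 5 rfl rfl rfl rfl
  have e5 := e 0 1 2 0 s01 (by decide) 0 5 1 3 rfl rfl rfl rfl
  have e6 := e 0 1 2 1 s01 (by decide) 0 5 1 4 rfl rfl rfl rfl
  have f1 := e 0 2 0 1 s02 (by decide) 0 3 2 4 rfl rfl rfl rfl
  have f2 := e 0 2 0 2 s02 (by decide) 0 3 2 5 rfl rfl rfl rfl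
  have f3 := e 0 2 1 0 s02 (by decide) 0 4 2 3 rfl rfl rfl rfl
  have f4 := e 0 2 1 2 s02 (by decide) 0 4 2 5 rfl rfl rfl rfl
  have f5 := e 0 2 2 0 s02 (by decide) 0 5 2 3 rfl rfl rfl rfl
  have f6 := e 0 2 2 1 s02 (by decide) 0 5 2 4 rfl rfl rfl rfl
  have g1 := e 1 2 0 1 s12 (by decide) 1 3 2 4 rfl rfl rfl rfl
  have g2 := e 1 2 0 2 s12 (by decide) 1 3 2 5 rfl rfl rfl rfl
  have g3 := e 1 2 1 0 s12 (by decide) 1 4 2 3 rfl rfl rfl rfl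
  have g4 := e 1 2 1 2 s12 (by decide) 1 4 2 5 rfl rfl rfl rfl
  have g5 := e 1 2 2 0 s12 (by decide) 1 5 2 3 rfl rfl rfl rfl
  have g6 := e 1 2 2 1 s12 (by decide) 1 5 2 4 rfl rfl rfl rfl
  have p : ∀ i j : Fin 6, i < j → pairSign i j = -1 := fun i j h => if_pos h
  have q : ∀ i j : Fin 6, ¬ i < j → pairSign i j = 1 := fun i j h => if_neg h
  clear e hne hm h0 h1 hc hD
  simp (discharger := decide) only [p, q] at e1 e2 e3 e4 e5 e6 f1 f2 f3 f4 f5 f6 g1 g2 g3 g4 g5 g6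
  clear p q
  -- Each turn number occurs in exactly two of the eighteen identities, with coefficient ±2, so its
  -- contribution to their sum is divisible by four. The signs add up to -18, which is not.
  generalize turns P = N at *
  omega

/-- There is no drawing of `K₅` in the plane in which independent edges are disjoint. -/
theorem not_drawing_K5 {X : Type*} [TopologicalSpace X] {f : X → ℂ} (hf : Continuous f)
    (hinj : Function.Injective f) (a : Fin 5 → X) (F : Fin 5 → Fin 5 → Set X)
    (hJ : ∀ i j, i < j → JoinedIn (F i j) (a i) (a j))
    (hD : ∀ i j k l, i < j → k < l → i < k → j ≠ k → j ≠ l → Disjoint (F i j) (F k l)) :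
    False := by
  let P : Fin 5 → ℂ := f ∘ a
  have hγ : ∀ i j, i < j → ∃ γ : ℝ → ℂ, Continuous γ ∧ γ 0 = P i ∧ γ 1 = P j ∧
      ∀ t, γ t ∈ f '' F i j := by
    intro i j h
    refine ⟨fun t => f ((hJ i j h).somePath.extend t),
      hf.comp (hJ i j h).somePath.continuous_extend, by simp [P], by simp [P], fun t => ⟨_, ?_, rfl⟩⟩
    simp only [Path.extend, Set.IccExtend]
    exact (hJ i j h).somePath_mem _
  choose! γ hc h0 h1 hm using hγ
  have e := fun (i j k l : Fin 5) (hi : i < j) (hk : k < l) (hik : i < k) (hj : j ≠ k)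
    (hl : j ≠ l) => turns_cell (P := P) (a := i) (b := j) (c := k) (d := l) (hc i j hi) (hc k l hk)
      (fun s t hst => by
        obtain ⟨x, hx, hx'⟩ := hm i j hi s
        obtain ⟨y, hy, hy'⟩ := hm k l hk t
        have : x = y := hinj (by rw [hx', hy', hst])
        exact Set.disjoint_left.1 (hD i j k l hi hk hik hj hl) hx (this ▸ hy))
      (h0 i j hi) (h1 i j hi) (h0 k l hk) (h1 k l hk)
  have e1 := e 0 1 2 3 (by decide) (by decide) (by decide) (by decide) (by decide)
  have e2 := e 0 1 2 4 (by decide) (by decide) (by decide) (by decide) (by decide)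
  have e3 := e 0 1 3 4 (by decide) (by decide) (by decide) (by decide) (by decide)
  have e4 := e 0 2 1 3 (by decide) (by decide) (by decide) (by decide) (by decide)
  have e5 := e 0 2 1 4 (by decide) (by decide) (by decide) (by decide) (by decide)
  have e6 := e 0 2 3 4 (by decide) (by decide) (by decide) (by decide) (by decide)
  have e7 := e 0 3 1 2 (by decide) (by decide) (by decide) (by decide) (by decide)
  have e8 := e 0 3 1 4 (by decide) (by decide) (by decide) (by decide) (by decide)
  have e9 := e 0 3 2 4 (by decide) (by decide) (by decide) (by decide) (by decide)
  have f1 := e 0 4 1 2 (by decide) (by decide) (by decide) (by decide) (by decide)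
  have f2 := e 0 4 1 3 (by decide) (by decide) (by decide) (by decide) (by decide)
  have f3 := e 0 4 2 3 (by decide) (by decide) (by decide) (by decide) (by decide)
  have f4 := e 1 2 3 4 (by decide) (by decide) (by decide) (by decide) (by decide)
  have f5 := e 1 3 2 4 (by decide) (by decide) (by decide) (by decide) (by decide)
  have f6 := e 1 4 2 3 (by decide) (by decide) (by decide) (by decide) (by decide)
  have p : ∀ i j : Fin 5, i < j → pairSign i j = -1 := fun i j h => if_pos h
  have q : ∀ i j : Fin 5, ¬ i < j → pairSign i j = 1 := fun i j h => if_neg h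
  clear e hm h0 h1 hc hD
  simp (discharger := decide) only [p, q] at e1 e2 e3 e4 e5 e6 e7 e8 e9 f1 f2 f3 f4 f5 f6
  clear p q
  -- The same count modulo four: each turn number again occurs twice with coefficient ±2. The signs
  -- contribute -2 for each of the five interleaved pairs i < k < j < l and 0 otherwise, in total
  -- -10.
  generalize turns P = N at *
  omega

/-! ### Arcs -/

/-- `F` is an embedded arc from `p` to `q`. -/
def IsArc {X : Type*} [TopologicalSpace X] (F : Set X) (p q : X) : Prop :=
  ∃ γ : ℝ → X, ContinuousOn γ (Set.Icc 0 1) ∧ Set.InjOn γ (Set.Icc 0 1) ∧ γ 0 = p ∧ γ 1 = q ∧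
    γ '' Set.Icc 0 1 = F

namespace IsArc

variable {X : Type*} [TopologicalSpace X] {F G : Set X} {p q r w : X}

theorem of_Icc {γ : ℝ → X} {a b : ℝ} (hab : a < b) (hc : ContinuousOn γ (Set.Icc a b))
    (hi : Set.InjOn γ (Set.Icc a b)) : IsArc (γ '' Set.Icc a b) (γ a) (γ b) := by
  have hba : 0 < b - a := sub_pos.2 hab
  have him : (fun t => a + t * (b - a)) '' Set.Icc 0 1 = Set.Icc a b := by
    ext x
    constructor
    · rintro ⟨t, ⟨h0, h1⟩, rfl⟩
      constructor <;> simp only <;> nlinarith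
    · rintro ⟨h0, h1⟩
      refine ⟨(x - a) / (b - a), ⟨div_nonneg (by linarith) hba.le, ?_⟩, ?_⟩
      · rw [div_le_one hba]; linarith
      · simp only; field_simp; ring
  have hmap : Set.MapsTo (fun t => a + t * (b - a)) (Set.Icc 0 1) (Set.Icc a b) :=
    fun t ht => him ▸ Set.mem_image_of_mem _ ht
  refine ⟨γ ∘ fun t => a + t * (b - a), hc.comp (by fun_prop) hmap, hi.comp ?_ hmap, by simp,
    by simp, by rw [Set.image_comp, him]⟩
  intro s _ t _ h
  simpa [hba.ne'] using h

theorem symm (h : IsArc F p q) : IsArc F q p := by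
  obtain ⟨γ, hc, hi, h0, h1, hF⟩ := h
  have him : (fun t : ℝ => 1 - t) '' Set.Icc 0 1 = Set.Icc 0 1 := by simp
  have hmap : Set.MapsTo (fun t : ℝ => 1 - t) (Set.Icc 0 1) (Set.Icc 0 1) :=
    fun t ht => him ▸ Set.mem_image_of_mem _ ht
  refine ⟨γ ∘ fun t => 1 - t, hc.comp (by fun_prop) hmap, hi.comp ?_ hmap, by simpa, by simpa,
    by rw [Set.image_comp, him, hF]⟩
  intro s _ t _ h
  simpa using h

theorem left_mem (h : IsArc F p q) : p ∈ F := by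
  obtain ⟨γ, -, -, h0, -, rfl⟩ := h
  exact ⟨0, by simp, h0⟩

theorem right_mem (h : IsArc F p q) : q ∈ F := h.symm.left_mem

theorem ne (h : IsArc F p q) : p ≠ q := by
  obtain ⟨γ, -, hi, rfl, rfl, -⟩ := h
  exact fun h => zero_ne_one (hi (by simp) (by simp) h)

theorem isCompact (h : IsArc F p q) : IsCompact F := by
  obtain ⟨γ, hc, -, -, -, rfl⟩ := h
  exact isCompact_Icc.image_of_continuousOn hc

theorem isClosed [T2Space X] (h : IsArc F p q) : IsClosed F := h.isCompact.isClosed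

theorem joinedIn (h : IsArc F p q) {Z : Set X} (hZ : F ⊆ Z) : JoinedIn Z p q := by
  obtain ⟨γ, hc, -, rfl, rfl, rfl⟩ := h
  have := ((convex_Icc (0 : ℝ) 1).isPathConnected ⟨0, by simp⟩).image' hc
  exact (this.joinedIn _ ⟨0, by simp⟩ _ ⟨1, by simp⟩).mono hZ

theorem split (h : IsArc F p q) (hw : w ∈ F) (hp : w ≠ p) (hq : w ≠ q) :
    ∃ F₁ F₂, IsArc F₁ p w ∧ IsArc F₂ w q ∧ F₁ ⊆ F ∧ F₂ ⊆ F ∧ F₁ ∩ F₂ = {w} := by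
  obtain ⟨γ, hc, hi, rfl, rfl, rfl⟩ := h
  obtain ⟨t, ⟨h0, h1⟩, rfl⟩ := hw
  have h0' : 0 < t := h0.lt_of_ne (by rintro rfl; exact hp rfl)
  have h1' : t < 1 := h1.lt_of_ne (by rintro rfl; exact hq rfl)
  have s1 : Set.Icc 0 t ⊆ Set.Icc 0 1 := Set.Icc_subset_Icc le_rfl h1
  have s2 : Set.Icc t 1 ⊆ Set.Icc 0 1 := Set.Icc_subset_Icc h0 le_rfl
  refine ⟨_, _, of_Icc h0' (hc.mono s1) (hi.mono s1), of_Icc h1' (hc.mono s2) (hi.mono s2),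
    Set.image_mono s1, Set.image_mono s2, ?_⟩
  rw [← hi.image_inter s1 s2, Set.Icc_inter_Icc_eq_singleton h0 h1, Set.image_singleton]

theorem trans (hF : IsArc F p q) (hG : IsArc G q r) (hd : F ∩ G ⊆ {q}) : IsArc (F ∪ G) p r := by
  obtain ⟨γ, hc, hi, rfl, rfl, rfl⟩ := hF
  obtain ⟨δ, hc', hi', h0', rfl, rfl⟩ := hG
  let ε : ℝ → X := fun t => if t ≤ 1 then γ t else δ (t - 1)
  have e1 : Set.EqOn ε γ (Set.Icc 0 1) := fun t ht => if_pos ht.2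
  have e2 : Set.EqOn ε (fun t => δ (t - 1)) (Set.Icc 1 2) := by
    intro t ht
    rcases ht.1.eq_or_lt with rfl | h
    · simp [ε, h0']
    · exact if_neg h.not_ge
  have hm : Set.MapsTo (fun t : ℝ => t - 1) (Set.Icc 1 2) (Set.Icc 0 1) := fun t ht =>
    ⟨by linarith [ht.1], by linarith [ht.2]⟩
  have him : (fun t : ℝ => t - 1) '' Set.Icc 1 2 = Set.Icc 0 1 := by simp; norm_num
  have hu : Set.Icc (0 : ℝ) 1 ∪ Set.Icc 1 2 = Set.Icc 0 2 :=
    Set.Icc_union_Icc_eq_Icc zero_le_one one_le_two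
  have c1 : ContinuousOn ε (Set.Icc 0 1) := hc.congr e1
  have c2 : ContinuousOn ε (Set.Icc 1 2) := (hc'.comp (by fun_prop) hm).congr e2
  have i1 : Set.InjOn ε (Set.Icc 0 1) := hi.congr e1.symm
  have i2 : Set.InjOn ε (Set.Icc 1 2) :=
    (hi'.comp (fun s _ t _ h => by simpa using h) hm).congr e2.symm
  have m1 : ε '' Set.Icc 0 1 = γ '' Set.Icc 0 1 := e1.image_eq
  have m2 : ε '' Set.Icc 1 2 = δ '' Set.Icc 0 1 := by
    rw [e2.image_eq, ← him, Set.image_image]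
  have key : ∀ s ∈ Set.Icc (0 : ℝ) 1, ∀ t ∈ Set.Icc (1 : ℝ) 2, ε s = ε t → s = t := by
    intro s hs t ht h
    have hq : ε s = γ 1 := hd ⟨m1 ▸ ⟨s, hs, rfl⟩, m2 ▸ ⟨t, ht, h.symm⟩⟩
    have h1 : ε 1 = γ 1 := e1 (by simp)
    have hs1 : s = 1 := i1 hs (by simp) (hq.trans h1.symm)
    have ht1 : t = 1 := i2 ht (by simp) (h.symm.trans (hq.trans h1.symm))
    rw [hs1, ht1]
  have := of_Icc (γ := ε) (a := 0) (b := 2) two_pos (hu ▸ c1.union_of_isClosed c2 isClosed_Icc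
    isClosed_Icc) (hu ▸ ?_)
  · rw [← hu, Set.image_union, m1, m2, e1 (by simp), e2 (by simp)] at this
    convert this using 2
    norm_num
  · rintro s (hs | hs) t (ht | ht) h
    · exact i1 hs ht h
    · exact key s hs t ht h
    · exact (key t ht s hs h.symm).symm
    · exact i2 hs ht h

/-- The initial piece of an arc up to the first point of a closed set. -/
theorem first_hit (h : IsArc F p q) {T : Set X} (hT : IsClosed T) (hp : p ∉ T) (hq : q ∈ T) :
    ∃ t F', F' ⊆ F ∧ IsArc F' p t ∧ F' ∩ T = {t} := by
  obtain ⟨γ, hc, hi, rfl, rfl, rfl⟩ := h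
  have hcl : IsCompact (Set.Icc 0 1 ∩ γ ⁻¹' T) :=
    isCompact_Icc.of_isClosed_subset (hc.preimage_isClosed_of_isClosed isClosed_Icc hT)
      Set.inter_subset_left
  obtain ⟨t, ⟨⟨h0, h1⟩, htT⟩, hmin⟩ := hcl.exists_isLeast ⟨1, by simp, hq⟩
  have h0' : 0 < t := h0.lt_of_ne (by rintro rfl; exact hp htT)
  have s1 : Set.Icc 0 t ⊆ Set.Icc 0 1 := Set.Icc_subset_Icc le_rfl h1
  refine ⟨γ t, _, Set.image_mono s1, of_Icc h0' (hc.mono s1) (hi.mono s1), ?_⟩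
  ext x
  constructor
  · rintro ⟨⟨s, hs, rfl⟩, hsT⟩
    rw [Set.mem_singleton_iff, le_antisymm hs.2 (hmin ⟨s1 hs, hsT⟩)]
  · rintro rfl
    exact ⟨⟨t, by simp [h0], rfl⟩, htT⟩

theorem tail (h : IsArc F p q) (hw : w ∈ F) (hq : w ≠ q) : ∃ G ⊆ F, IsArc G w q := by
  rcases eq_or_ne w p with rfl | hp
  · exact ⟨F, subset_rfl, h⟩
  · obtain ⟨-, G, -, hG, -, hs, -⟩ := h.split hw hp hq
    exact ⟨G, hs, hG⟩

/-- The concatenation need not be injective. Leaving F at its first point on G and continuing along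
G repairs this. -/
theorem splice [T2Space X] (hF : IsArc F p q) (hG : IsArc G q r) (hpr : p ≠ r) :
    ∃ E ⊆ F ∪ G, IsArc E p r := by
  by_cases hp : p ∈ G
  · obtain ⟨E, hE, h⟩ := hG.tail hp hpr
    exact ⟨E, hE.trans Set.subset_union_right, h⟩
  obtain ⟨t, F', hF', h, ht⟩ := hF.first_hit hG.isClosed hp hG.left_mem
  have htG : t ∈ G := (ht.symm.subset rfl).2
  by_cases htr : t = r
  · exact ⟨F', hF'.trans Set.subset_union_left, htr ▸ h⟩
  obtain ⟨G', hG', h'⟩ := hG.tail htG htr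
  exact ⟨_, Set.union_subset_union hF' hG',
    h.trans h' ((Set.inter_subset_inter_right _ hG').trans ht.subset)⟩

/-- A parametrization of an arc by the unit interval. -/
theorem exists_continuousMap (h : IsArc F p q) : ∃ γ : C(unitInterval, X),
    Function.Injective γ ∧ γ 0 = p ∧ γ 1 = q ∧ Set.range γ = F := by
  obtain ⟨γ, hc, hi, h0, h1, hF⟩ := h
  refine ⟨⟨fun t => γ t, continuousOn_iff_continuous_domRestrict.1 hc⟩, ?_, h0, h1, ?_⟩
  · intro s t h
    exact Subtype.ext (hi s.2 t.2 h)
  · rw [← hF]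
    ext x
    constructor
    · rintro ⟨t, rfl⟩
      exact ⟨t, t.2, rfl⟩
    · rintro ⟨t, ht, rfl⟩
      exact ⟨⟨t, ht⟩, rfl⟩

theorem of_continuousMap {γ : C(unitInterval, X)} (hγ : Function.Injective γ) :
    IsArc (Set.range γ) (γ 0) (γ 1) := by
  refine ⟨Set.IccExtend zero_le_one γ, ?_, ?_, ?_, ?_, ?_⟩
  · exact (γ.continuous.Icc_extend' (h := zero_le_one)).continuousOn
  · intro s hs t ht h
    rw [Set.IccExtend_of_mem _ _ hs, Set.IccExtend_of_mem _ _ ht] at h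
    exact congr_arg Subtype.val (hγ h)
  · simp
  · simp
  · ext x
    constructor
    · rintro ⟨t, ht, rfl⟩
      exact ⟨⟨t, ht⟩, (Set.IccExtend_of_mem _ _ ht).symm⟩
    · rintro ⟨t, rfl⟩
      exact ⟨t, t.2, Set.IccExtend_of_mem _ _ t.2⟩

end IsArc

/-- `p` and `q` coincide or are joined by an arc in `Z`. -/
def ArcJoined {X : Type*} [TopologicalSpace X] (Z : Set X) (p q : X) : Prop :=
  p ∈ Z ∧ p = q ∨ ∃ F ⊆ Z, IsArc F p q

namespace ArcJoined

variable {X : Type*} [TopologicalSpace X] {Z : Set X} {p q r : X}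

theorem symm (h : ArcJoined Z p q) : ArcJoined Z q p := by
  rcases h with ⟨h, rfl⟩ | ⟨F, hF, h⟩
  · exact .inl ⟨h, rfl⟩
  · exact .inr ⟨F, hF, h.symm⟩

theorem left_mem (h : ArcJoined Z p q) : p ∈ Z := by
  rcases h with ⟨h, rfl⟩ | ⟨F, hF, h⟩
  · exact h
  · exact hF h.left_mem

theorem right_mem (h : ArcJoined Z p q) : q ∈ Z := h.symm.left_mem

theorem trans [T2Space X] (h₁ : ArcJoined Z p q) (h₂ : ArcJoined Z q r) : ArcJoined Z p r := by
  rcases eq_or_ne p r with rfl | hpr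
  · exact .inl ⟨h₁.left_mem, rfl⟩
  rcases h₁ with ⟨-, rfl⟩ | ⟨F, hF, h⟩
  · exact h₂
  rcases h₂ with ⟨-, rfl⟩ | ⟨G, hG, h'⟩
  · exact .inr ⟨F, hF, h⟩
  obtain ⟨E, hE, h''⟩ := h.splice h' hpr
  exact .inr ⟨E, hE.trans (Set.union_subset hF hG), h''⟩

theorem mono (h : ArcJoined Z p q) {W : Set X} (hW : Z ⊆ W) : ArcJoined W p q := by
  rcases h with ⟨h, rfl⟩ | ⟨F, hF, h⟩
  · exact .inl ⟨hW h, rfl⟩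
  · exact .inr ⟨F, hF.trans hW, h⟩

theorem joinedIn (h : ArcJoined Z p q) : JoinedIn Z p q := by
  rcases h with ⟨h, rfl⟩ | ⟨F, hF, h⟩
  · exact JoinedIn.refl h
  · exact h.joinedIn hF

theorem exists_isArc (h : ArcJoined Z p q) (hpq : p ≠ q) : ∃ F ⊆ Z, IsArc F p q :=
  h.resolve_left fun h => hpq h.2

end ArcJoined

/-! ### Charts of graphs and complements of loops -/

theorem JoinedIn.mem_connectedComponentIn {X : Type*} [TopologicalSpace X] {Z : Set X} {p q : X}
    (h : JoinedIn Z p q) : q ∈ connectedComponentIn Z p :=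
  (isPathConnected_pathComponentIn h.source_mem).isConnected.isPreconnected.subset_connectedComponentIn
    (JoinedIn.refl h.source_mem) pathComponentIn_subset h

theorem AddCircle.injOn_coe {a b : ℝ} (h : b < a + 1) :
    Set.InjOn (fun t : ℝ => (t : AddCircle (1 : ℝ))) (Set.Icc a b) := by
  intro s hs t ht hst
  exact (AddCircle.coe_eq_coe_iff_of_mem_Ico (a := a) ⟨hs.1, hs.2.trans_lt h⟩
    ⟨ht.1, ht.2.trans_lt h⟩).1 hst

/-- A presentation of the subset `Y` of `X` as the realization of the simple graph `H`. -/
structure GraphChart {X W : Type*} [TopologicalSpace X] (Y : Set X) (H : SimpleGraph W) where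
  vert : W → X
  edge : W → W → ℝ → X
  edge_zero : ∀ {u w}, H.Adj u w → edge u w 0 = vert u
  edge_cont : ∀ {u w}, H.Adj u w → ContinuousOn (edge u w) (Set.Icc 0 1)
  edge_inj : ∀ {u w}, H.Adj u w → Set.InjOn (edge u w) (Set.Icc 0 1)
  edge_symm : ∀ u w t, edge u w (1 - t) = edge w u t
  vert_inj : Function.Injective vert
  vert_mem : ∀ u, vert u ∈ Y
  edge_mem : ∀ {u w t}, H.Adj u w → t ∈ Set.Icc (0 : ℝ) 1 → edge u w t ∈ Y
  cover : ∀ {z}, z ∈ Y → (∃ u, z = vert u) ∨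
    ∃ u w, H.Adj u w ∧ ∃ t ∈ Set.Ioo (0 : ℝ) 1, edge u w t = z
  edge_ne_vert : ∀ {u w t k}, H.Adj u w → t ∈ Set.Ioo (0 : ℝ) 1 → edge u w t ≠ vert k
  edge_eq_edge : ∀ {u w u' w' t t'}, H.Adj u w → H.Adj u' w' → t ∈ Set.Ioo (0 : ℝ) 1 →
    t' ∈ Set.Ioo (0 : ℝ) 1 → edge u w t = edge u' w' t' → u = u' ∧ w = w' ∨ u = w' ∧ w = u'

namespace GraphChart

variable {X W : Type*} [TopologicalSpace X] {Y : Set X} {H : SimpleGraph W} (c : GraphChart Y H)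

/-- The open edge. -/
def inner (u w : W) : Set X := c.edge u w '' Set.Ioo 0 1

theorem edge_one {u w : W} (h : H.Adj u w) : c.edge u w 1 = c.vert w := by
  rw [← c.edge_zero h.symm, ← c.edge_symm u w 0, sub_zero]

theorem inner_comm (u w : W) : c.inner u w = c.inner w u := by
  have : ∀ u w, c.inner u w ⊆ c.inner w u := by
    rintro u w _ ⟨t, ht, rfl⟩
    refine ⟨1 - t, ⟨by linarith [ht.2], by linarith [ht.1]⟩, ?_⟩
    rw [c.edge_symm]
  exact (this u w).antisymm (this w u)

theorem inner_subset {u w : W} (h : H.Adj u w) : c.inner u w ⊆ Y := by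
  rintro _ ⟨t, ht, rfl⟩
  exact c.edge_mem h (Set.Ioo_subset_Icc_self ht)

theorem vert_notMem_inner {u w : W} (h : H.Adj u w) (k : W) : c.vert k ∉ c.inner u w := by
  rintro ⟨t, ht, h'⟩
  exact c.edge_ne_vert h ht h'

/-- A union of vertices and closed edges. -/
def skeleton (V : Set W) (Q : W → W → Prop) : Set X :=
  c.vert '' V ∪ ⋃ (u : W) (w : W) (_ : H.Adj u w ∧ Q u w), c.edge u w '' Set.Icc 0 1

theorem isClosed_skeleton [T2Space X] [Finite W] (V : Set W) (Q : W → W → Prop) :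
    IsClosed (c.skeleton V Q) := by
  refine ((Set.toFinite V).image _).isClosed.union ?_
  refine isClosed_iUnion_of_finite fun u => isClosed_iUnion_of_finite fun w =>
    isClosed_iUnion_of_finite fun h => ?_
  exact (isCompact_Icc.image_of_continuousOn (c.edge_cont h.1)).isClosed

theorem mem_edge_cases {u w : W} (h : H.Adj u w) {z : X} (hz : z ∈ c.edge u w '' Set.Icc 0 1) :
    z = c.vert u ∨ z = c.vert w ∨ z ∈ c.inner u w := by
  obtain ⟨t, ht, rfl⟩ := hz
  rcases ht.1.eq_or_lt with rfl | h0
  · exact .inl (c.edge_zero h)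
  rcases ht.2.eq_or_lt with rfl | h1
  · exact .inr (.inl (c.edge_one h))
  · exact .inr (.inr ⟨t, ⟨h0, h1⟩, rfl⟩)

/-- The vertices and the other closed edges form a finite union of compact sets; the complement of
this union is the required open set. -/
theorem exists_isOpen_inner [T2Space X] [Finite W] {u w : W} (h : H.Adj u w) :
    ∃ O, IsOpen O ∧ O ∩ Y = c.inner u w := by
  let Q : W → W → Prop := fun u' w' => ¬ (u = u' ∧ w = w' ∨ u = w' ∧ w = u')
  refine ⟨_, (c.isClosed_skeleton Set.univ Q).isOpen_compl, ?_⟩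
  ext z
  constructor
  · rintro ⟨hz, hY⟩
    rcases c.cover hY with ⟨k, rfl⟩ | ⟨u', w', h', t, ht, rfl⟩
    · exact absurd (.inl ⟨k, trivial, rfl⟩) hz
    · by_cases hQ : Q u' w'
      · refine absurd (.inr ?_) hz
        simp only [Set.mem_iUnion]
        exact ⟨u', w', ⟨h', hQ⟩, t, Set.Ioo_subset_Icc_self ht, rfl⟩
      · rcases not_not.1 hQ with ⟨rfl, rfl⟩ | ⟨rfl, rfl⟩
        · exact ⟨t, ht, rfl⟩
        · rw [c.inner_comm]
          exact ⟨t, ht, rfl⟩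
  · intro hz
    refine ⟨?_, c.inner_subset h hz⟩
    rintro (⟨k, -, rfl⟩ | hz')
    · exact c.vert_notMem_inner h k hz
    · simp only [Set.mem_iUnion] at hz'
      obtain ⟨u', w', ⟨h', hQ⟩, hz'⟩ := hz'
      rcases c.mem_edge_cases h' hz' with rfl | rfl | hz'
      · exact c.vert_notMem_inner h _ hz
      · exact c.vert_notMem_inner h _ hz
      · obtain ⟨t, ht, rfl⟩ := hz
        obtain ⟨t', ht', h''⟩ := hz'
        exact hQ (c.edge_eq_edge h h' ht ht' h''.symm)

/-- The open star of a vertex. -/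
def star (k : W) : Set X := insert (c.vert k) (⋃ (w : W) (_ : H.Adj k w), c.inner k w)

theorem exists_isOpen_star [T2Space X] [Finite W] (k : W) :
    ∃ O, IsOpen O ∧ c.vert k ∈ O ∧ O ∩ Y ⊆ c.star k := by
  let Q : W → W → Prop := fun u w => u ≠ k ∧ w ≠ k
  refine ⟨_, (c.isClosed_skeleton {k}ᶜ Q).isOpen_compl, ?_, ?_⟩
  · rintro (⟨l, hl, h⟩ | hz')
    · exact hl (c.vert_inj h)
    · simp only [Set.mem_iUnion] at hz'
      obtain ⟨u', w', ⟨h', hQ⟩, hz'⟩ := hz'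
      rcases c.mem_edge_cases h' hz' with h | h | h
      · exact hQ.1 (c.vert_inj h).symm
      · exact hQ.2 (c.vert_inj h).symm
      · exact c.vert_notMem_inner h' _ h
  · rintro z ⟨hz, hY⟩
    rcases c.cover hY with ⟨l, rfl⟩ | ⟨u', w', h', t, ht, rfl⟩
    · by_cases hl : l = k
      · exact .inl (hl ▸ rfl)
      · exact absurd (.inl ⟨l, hl, rfl⟩) hz
    · by_cases hQ : Q u' w'
      · refine absurd (.inr ?_) hz
        simp only [Set.mem_iUnion]
        exact ⟨u', w', ⟨h', hQ⟩, t, Set.Ioo_subset_Icc_self ht, rfl⟩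
      · right
        simp only [Set.mem_iUnion]
        rcases eq_or_ne u' k with rfl | hu
        · exact ⟨w', h', t, ht, rfl⟩
        · obtain rfl : w' = k := not_not.1 fun hw => hQ ⟨hu, hw⟩
          refine ⟨u', h'.symm, ?_⟩
          rw [c.inner_comm]
          exact ⟨t, ht, rfl⟩

theorem isArc_edge {u w : W} (h : H.Adj u w) {s t : ℝ} (hs : 0 ≤ s) (hst : s < t) (ht : t ≤ 1) :
    IsArc (c.edge u w '' Set.Icc s t) (c.edge u w s) (c.edge u w t) :=
  IsArc.of_Icc hst ((c.edge_cont h).mono (Set.Icc_subset_Icc hs ht))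
    ((c.edge_inj h).mono (Set.Icc_subset_Icc hs ht))

theorem arcJoined_inner {u w : W} (h : H.Adj u w) {p q : X} (hp : p ∈ c.inner u w)
    (hq : q ∈ c.inner u w) : ArcJoined (c.inner u w) p q := by
  obtain ⟨s, hs, rfl⟩ := hp
  obtain ⟨t, ht, rfl⟩ := hq
  rcases lt_trichotomy s t with hst | rfl | hst
  · exact .inr ⟨_, Set.image_mono (fun x hx => ⟨hs.1.trans_le hx.1, hx.2.trans_lt ht.2⟩),
      c.isArc_edge h hs.1.le hst ht.2.le⟩
  · exact .inl ⟨⟨s, hs, rfl⟩, rfl⟩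
  · exact .inr ⟨_, Set.image_mono (fun x hx => ⟨ht.1.trans_le hx.1, hx.2.trans_lt hs.2⟩),
      (c.isArc_edge h ht.1.le hst hs.2.le).symm⟩

theorem arcJoined_vert {u w : W} (h : H.Adj u w) {q : X} (hq : q ∈ c.inner u w) :
    ArcJoined (insert (c.vert u) (c.inner u w)) (c.vert u) q := by
  obtain ⟨t, ht, rfl⟩ := hq
  refine .inr ⟨_, ?_, c.edge_zero h ▸ c.isArc_edge h le_rfl ht.1 ht.2.le⟩
  rintro _ ⟨s, hs, rfl⟩
  rcases hs.1.eq_or_lt with rfl | h0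
  · exact .inl (c.edge_zero h)
  · exact .inr ⟨s, ⟨h0, hs.2.trans_lt ht.2⟩, rfl⟩

theorem inner_nonempty (u w : W) : (c.inner u w).Nonempty :=
  ⟨_, 1 / 2, ⟨by norm_num, by norm_num⟩, rfl⟩

theorem vert_mem_of_inner_subset {u w : W} (h : H.Adj u w) {L : Set X} (hL : IsClosed L)
    (hs : c.inner u w ⊆ L) : c.vert u ∈ L := by
  have hc : closure (Set.Ioo (0 : ℝ) 1) = Set.Icc 0 1 := closure_Ioo zero_ne_one
  have := (c.edge_cont h)
  rw [← hc] at this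
  refine closure_minimal hs hL (this.image_closure ⟨0, by simp [hc], c.edge_zero h⟩)

/-- An open edge is contained in a loop or disjoint from it. -/
theorem inner_subset_or_disjoint [T2Space X] [Finite W] {S : C(AddCircle (1 : ℝ), X)}
    (hS : Function.Injective S) (hSY : Set.range S ⊆ Y) {u w : W} (h : H.Adj u w) :
    c.inner u w ⊆ Set.range S ∨ Disjoint (c.inner u w) (Set.range S) := by
  refine or_iff_not_imp_right.2 fun hnd => ?_
  obtain ⟨x, ⟨t₀, ht₀, rfl⟩, hx⟩ := Set.not_disjoint_iff.1 hnd
  let D : Set ℝ := {t | t ∈ Set.Ioo (0 : ℝ) 1 ∧ c.edge u w t ∈ Set.range S}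
  have hLc : IsClosed (Set.range S) := (isCompact_range S.continuous).isClosed
  obtain ⟨O, hO, hOY⟩ := c.exists_isOpen_inner h
  let e : Set.Icc (0 : ℝ) 1 → X := fun t => c.edge u w t
  have he : Topology.IsClosedEmbedding e :=
    (continuousOn_iff_continuous_domRestrict.1 (c.edge_cont h)).isClosedEmbedding
      fun s t hst => Subtype.ext (c.edge_inj h s.2 t.2 hst)
  -- Invariance of domain in dimension one. Near the given point the loop stays inside the open
  -- edge, and reading it in the edge parameter gives a continuous injective function g on an
  -- interval. Such a g is strictly monotone, so by the intermediate value theorem its image is a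
  -- neighbourhood of t.
  have hDo : IsOpen D := by
    rw [isOpen_iff_mem_nhds]
    rintro t ⟨ht, s, hs⟩
    obtain ⟨r, rfl⟩ := QuotientAddGroup.mk_surjective s
    have hcont : Continuous fun r : ℝ => S (r : AddCircle (1 : ℝ)) :=
      S.continuous.comp (AddCircle.continuous_mk' 1)
    have hrO : (fun r : ℝ => S (r : AddCircle (1 : ℝ))) ⁻¹' O ∈ nhds r := by
      refine (hO.preimage hcont).mem_nhds ?_
      have : c.edge u w t ∈ O ∩ Y := hOY ▸ ⟨t, ht, rfl⟩
      exact (hs.symm ▸ this.1 : _)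
    obtain ⟨ε, hε, hball⟩ := Metric.mem_nhds_iff.1 hrO
    -- The bound 1 / 2 keeps the interval shorter than one period, so that the loop is injective on
    -- it.
    obtain ⟨δ, hδ0, hδε, hδ⟩ : ∃ δ, 0 < δ ∧ δ < ε ∧ δ < 1 / 2 :=
      ⟨min ε (1 / 2) / 2, by positivity, by linarith [min_le_left ε (1 / 2 : ℝ)],
        by linarith [min_le_right ε (1 / 2 : ℝ)]⟩
    have hin : ∀ x ∈ Set.Icc (r - δ) (r + δ), ∃ y : Set.Icc (0 : ℝ) 1,
        (y : ℝ) ∈ Set.Ioo (0 : ℝ) 1 ∧ e y = S (x : AddCircle (1 : ℝ)) := by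
      intro x hx
      have : S (x : AddCircle (1 : ℝ)) ∈ O ∩ Y := by
        refine ⟨hball (?_ : dist x r < ε), hSY ⟨_, rfl⟩⟩
        rw [Real.dist_eq, abs_lt]
        constructor <;> linarith [hx.1, hx.2]
      rw [hOY] at this
      obtain ⟨y, hy, hy'⟩ := this
      exact ⟨⟨y, Set.Ioo_subset_Icc_self hy⟩, hy, hy'⟩
    choose! g hg hge using hin
    have hgc : ContinuousOn g (Set.Icc (r - δ) (r + δ)) :=
      he.isInducing.continuousOn_iff.2 (hcont.continuousOn.congr hge)
    have hgc' : ContinuousOn (fun x => (g x : ℝ)) (Set.Icc (r - δ) (r + δ)) :=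
      continuous_subtype_val.comp_continuousOn hgc
    have hgi : Set.InjOn (fun x => (g x : ℝ)) (Set.Icc (r - δ) (r + δ)) := by
      intro x hx y hy hxy
      have : S (x : AddCircle (1 : ℝ)) = S (y : AddCircle (1 : ℝ)) := by
        rw [← hge x hx, ← hge y hy, Subtype.ext hxy]
      exact AddCircle.injOn_coe (by linarith) hx hy (hS this)
    have hrm : r ∈ Set.Icc (r - δ) (r + δ) := ⟨by linarith, by linarith⟩
    have hlm : r - δ ∈ Set.Icc (r - δ) (r + δ) := ⟨by linarith, by linarith⟩
    have hum : r + δ ∈ Set.Icc (r - δ) (r + δ) := ⟨by linarith, by linarith⟩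
    have hgr : (g r : ℝ) = t :=
      c.edge_inj h (g r).2 (Set.Ioo_subset_Icc_self ht) ((hge r hrm).trans hs)
    have hsub : (fun x => (g x : ℝ)) '' Set.Icc (r - δ) (r + δ) ⊆ D := by
      rintro _ ⟨x, hx, rfl⟩
      exact ⟨hg x hx, _, (hge x hx).symm⟩
    refine Filter.mem_of_superset ?_ hsub
    rw [← hgr]
    rcases hgc'.strictMonoOn_of_injOn_Icc' (by linarith) hgi with hm | hm
    · exact Filter.mem_of_superset (Icc_mem_nhds (hm hlm hrm (by linarith))
        (hm hrm hum (by linarith))) (intermediate_value_Icc (by linarith) hgc')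
    · exact Filter.mem_of_superset (Icc_mem_nhds (hm hrm hum (by linarith))
        (hm hlm hrm (by linarith))) (intermediate_value_Icc' (by linarith) hgc')
  -- The set D is also relatively closed in the open interval, because the loop is compact;
  -- connectedness finishes.
  have hall : Set.Ioo (0 : ℝ) 1 ⊆ D := by
    refine isPreconnected_Ioo.subset_of_closure_inter_subset hDo ⟨t₀, ht₀, ht₀, hx⟩ ?_
    rintro t ⟨htD, ht⟩
    refine ⟨ht, ?_⟩
    have hD : D ⊆ Set.Icc 0 1 := fun s hs => Set.Ioo_subset_Icc_self hs.1
    have hDc : closure D ⊆ Set.Icc 0 1 := closure_minimal hD isClosed_Icc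
    refine closure_minimal ?_ hLc (((c.edge_cont h).mono hDc).image_closure ⟨t, htD, rfl⟩)
    rintro _ ⟨s, hs, rfl⟩
    exact hs.2
  rintro _ ⟨t, ht, rfl⟩
  exact (hall ht).2

/-! ### Components of the complement of a subgraph -/

/-- Every open edge is contained in `L` or disjoint from it. -/
def Saturates (L : Set X) : Prop :=
  ∀ u w, H.Adj u w → c.inner u w ⊆ L ∨ Disjoint (c.inner u w) L

variable {L : Set X} {c}

/-- A vertex off the closed set L has its whole open star off L: an open edge inside L would have
its ends in L. A point inside an edge off L has that open edge as a neighbourhood. -/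
theorem Saturates.exists_nhds [T2Space X] [Finite W] (hL : c.Saturates L) (hLc : IsClosed L)
    {z : X} (hz : z ∈ Y \ L) : ∃ O, IsOpen O ∧ z ∈ O ∧ ∀ q ∈ O ∩ Y, ArcJoined (Y \ L) z q := by
  rcases c.cover hz.1 with ⟨k, rfl⟩ | ⟨u, w, h, t, ht, rfl⟩
  · obtain ⟨O, hO, hk, hs⟩ := c.exists_isOpen_star k
    refine ⟨O, hO, hk, fun q hq => ?_⟩
    rcases hs hq with rfl | hq
    · exact .inl ⟨hz, rfl⟩
    · simp only [Set.mem_iUnion] at hq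
      obtain ⟨w, h, hq⟩ := hq
      refine (c.arcJoined_vert h hq).mono (Set.insert_subset hz fun x hx => ⟨c.inner_subset h hx, ?_⟩)
      rcases hL _ _ h with h' | h'
      · exact absurd (c.vert_mem_of_inner_subset h hLc h') hz.2
      · exact Set.disjoint_left.1 h' hx
  · obtain ⟨O, hO, hOY⟩ := c.exists_isOpen_inner h
    have hm : c.edge u w t ∈ c.inner u w := ⟨t, ht, rfl⟩
    refine ⟨O, hO, (hOY ▸ hm : _ ∈ O ∩ Y).1, fun q hq => ?_⟩
    rw [hOY] at hq
    refine (c.arcJoined_inner h hm hq).mono fun x hx => ⟨c.inner_subset h hx, ?_⟩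
    rcases hL _ _ h with h' | h'
    · exact absurd (h' hm) hz.2
    · exact Set.disjoint_left.1 h' hx

end GraphChart

theorem ArcJoined.connectedComponentIn {X : Type*} [TopologicalSpace X] {Z : Set X} {p q : X}
    (h : ArcJoined Z p q) : ArcJoined (connectedComponentIn Z p) p q := by
  rcases h with ⟨h, rfl⟩ | ⟨F, hF, h⟩
  · exact .inl ⟨mem_connectedComponentIn h, rfl⟩
  · refine .inr ⟨F, fun x hx => ?_, h⟩
    have hc : IsPreconnected F := by
      obtain ⟨γ, hc, -, -, -, rfl⟩ := h
      exact isPreconnected_Icc.image _ hc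
    exact hc.subset_connectedComponentIn h.left_mem hF hx

namespace GraphChart

variable {X W : Type*} [TopologicalSpace X] {Y : Set X} {H : SimpleGraph W} {c : GraphChart Y H}
  {L : Set X}

/-- Being joined by an arc is an equivalence relation that holds locally by `Saturates.exists_nhds`,
so it holds throughout a connected set. -/
theorem Saturates.arcJoined [T2Space X] [Finite W] (hL : c.Saturates L) (hLc : IsClosed L)
    {z p q : X} (hp : p ∈ connectedComponentIn (Y \ L) z)
    (hq : q ∈ connectedComponentIn (Y \ L) z) : ArcJoined (connectedComponentIn (Y \ L) z) p q := by
  refine isPreconnected_connectedComponentIn.induction₂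
    (fun p q => ArcJoined (connectedComponentIn (Y \ L) z) p q) ?_
    (fun _ _ _ _ _ _ h h' => h.trans h') (fun _ _ _ _ h => h.symm) hp hq
  intro x hx
  have hxZ := connectedComponentIn_subset _ _ hx
  obtain ⟨O, hO, hxO, h⟩ := hL.exists_nhds hLc hxZ
  filter_upwards [self_mem_nhdsWithin, mem_nhdsWithin_of_mem_nhds (hO.mem_nhds hxO)] with y hy hyO
  rw [connectedComponentIn_eq hx]
  exact (h y ⟨hyO, (connectedComponentIn_subset _ _ hy).1⟩).connectedComponentIn

end GraphChart

/-- The set `K` can be reached from `p` by an arc. -/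
def Attaches {X : Type*} [TopologicalSpace X] (K : Set X) (p : X) : Prop :=
  ∃ q ∈ K, ArcJoined (insert p K) p q

namespace GraphChart

variable {X W : Type*} [TopologicalSpace X] {Y : Set X} {H : SimpleGraph W} {c : GraphChart Y H}
  {L : Set X}

theorem Saturates.attaches [T2Space X] [Finite W] (hL : c.Saturates L) (hLc : IsClosed L)
    {z p q : X} (h : Attaches (connectedComponentIn (Y \ L) z) p)
    (hq : q ∈ connectedComponentIn (Y \ L) z) :
    ArcJoined (insert p (connectedComponentIn (Y \ L) z)) p q := by
  obtain ⟨q', hq', h⟩ := h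
  exact h.trans ((hL.arcJoined hLc hq' hq).mono (Set.subset_insert _ _))

/-- At a point of L inside an edge, that open edge lies in L and is a neighbourhood of the point in
Y. An arc starting there cannot enter the complement of L at once, as an attaching arc must. -/
theorem Saturates.exists_vert [T2Space X] [Finite W] (hL : c.Saturates L)
    {z p : X} (h : Attaches (connectedComponentIn (Y \ L) z) p) (hp : p ∈ L) (hpY : p ∈ Y) :
    ∃ u, c.vert u = p := by
  rcases c.cover hpY with ⟨u, rfl⟩ | ⟨u, w, huw, t, ht, rfl⟩
  · exact ⟨u, rfl⟩
  exfalso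
  have hsub := connectedComponentIn_subset (Y \ L) z
  have hin : c.inner u w ⊆ L := (hL u w huw).resolve_right
    (Set.not_disjoint_iff.2 ⟨_, ⟨t, ht, rfl⟩, hp⟩)
  obtain ⟨q, hq, h⟩ := h
  have hpq : c.edge u w t ≠ q := by rintro rfl; exact (hsub hq).2 hp
  obtain ⟨F, hF, γ, hc, hi, h0, h1, rfl⟩ := h.exists_isArc hpq
  obtain ⟨O, hO, hOY⟩ := c.exists_isOpen_inner huw
  have hpO : c.edge u w t ∈ O := (hOY ▸ ⟨t, ht, rfl⟩ : c.edge u w t ∈ O ∩ Y).1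
  have h2 : γ ⁻¹' O ∈ nhdsWithin 0 (Set.Ioc (0 : ℝ) 1) :=
    ((hc 0 (by simp)).mono Set.Ioc_subset_Icc_self) (hO.mem_nhds (h0.symm ▸ hpO))
  have : (nhdsWithin (0 : ℝ) (Set.Ioc 0 1)).NeBot := by
    rw [nhdsWithin_Ioc_eq_nhdsGT zero_lt_one]; infer_instance
  obtain ⟨s, hsO, hs⟩ := Filter.nonempty_of_mem (Filter.inter_mem h2 self_mem_nhdsWithin)
  have hs' : s ∈ Set.Icc (0 : ℝ) 1 := Set.Ioc_subset_Icc_self hs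
  rcases hF ⟨s, hs', rfl⟩ with h | h
  · exact hs.1.ne' (hi hs' (by simp) (h.trans h0.symm))
  · exact (hsub h).2 (hin (hOY ▸ ⟨hsO, (hsub h).1⟩))

theorem Saturates.inner_subset_component (hL : c.Saturates L) {u w : W} (h : H.Adj u w) {z : X}
    (hz : z ∈ c.inner u w) (hzL : z ∉ L) : c.inner u w ⊆ connectedComponentIn (Y \ L) z := by
  have hd := (hL u w h).resolve_left fun h => hzL (h hz)
  refine (isPreconnected_Ioo.image _ ((c.edge_cont h).mono
    Set.Ioo_subset_Icc_self)).subset_connectedComponentIn hz fun x hx => ⟨c.inner_subset h hx, ?_⟩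
  exact Set.disjoint_left.1 hd hx

theorem Saturates.vert_component (hL : c.Saturates L) {u w : W} (h : H.Adj u w) {z : X}
    (hz : z ∈ c.inner u w) (hzL : z ∉ L) (hu : c.vert u ∉ L) :
    c.vert u ∈ connectedComponentIn (Y \ L) z := by
  have hd := (hL u w h).resolve_left fun h => hzL (h hz)
  refine ((c.arcJoined_vert h hz).mono (W := Y \ L) ?_).symm.joinedIn.mem_connectedComponentIn
  exact Set.insert_subset ⟨c.vert_mem u, hu⟩
    fun x hx => ⟨c.inner_subset h hx, Set.disjoint_left.1 hd hx⟩

theorem Saturates.attaches_vert (hL : c.Saturates L) {u w : W} (h : H.Adj u w) {z : X}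
    (hz : z ∈ c.inner u w) (hzL : z ∉ L) : Attaches (connectedComponentIn (Y \ L) z) (c.vert u) :=
  ⟨z, hL.inner_subset_component h hz hzL hz, (c.arcJoined_vert h hz).mono
    (Set.insert_subset_insert (hL.inner_subset_component h hz hzL))⟩

end GraphChart

/-! ### The chart of a geometric realization -/

theorem mem_graphRealization_of_adj {W : Type*} [DecidableEq W] {H : SimpleGraph W} {u w : W}
    (h : H.Adj u w) {t : ℝ} (ht : t ∈ Set.Icc (0 : ℝ) 1) :
    (1 - t) • Pi.single u (1 : ℝ) + t • Pi.single w (1 : ℝ) ∈ graphRealization H :=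
  ⟨u, w, .inr h, by rw [segment_eq_image]; exact ⟨t, ht, rfl⟩⟩

/-- A point of an open segment determines the two ends of the segment as its nonzero coordinates.
Hence distinct open edges are disjoint and contain no vertex. -/
theorem edgePoint_ne_zero_iff {W : Type*} [DecidableEq W] {u w k : W} (h : u ≠ w) {t : ℝ}
    (ht : t ∈ Set.Ioo (0 : ℝ) 1) :
    ((1 - t) • Pi.single u (1 : ℝ) + t • Pi.single w (1 : ℝ) : W → ℝ) k ≠ 0 ↔ k = u ∨ k = w := by
  have h1 : 1 - t ≠ 0 := by linarith [ht.2]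
  have h0 : t ≠ 0 := ht.1.ne'
  by_cases hu : k = u
  · subst hu
    simp [h, h1]
  · by_cases hw : k = w
    · subst hw
      simp [hu, h0]
    · simp [hu, hw]

/-- The chart given by a parametrization of `Y` by the geometric realization of `H`. -/
noncomputable def GraphChart.ofRealization {X W : Type*} [TopologicalSpace X] [DecidableEq W]
    {Y : Set X} {H : SimpleGraph W} {φ : (W → ℝ) → X} (hc : ContinuousOn φ (graphRealization H))
    (hi : Set.InjOn φ (graphRealization H)) (hY : φ '' graphRealization H = Y) :
    GraphChart Y H where
  vert u := φ (Pi.single u 1)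
  edge u w t := φ ((1 - t) • Pi.single u 1 + t • Pi.single w 1)
  edge_zero _ := by simp
  edge_cont h := hc.comp (by fun_prop) fun t ht => mem_graphRealization_of_adj h ht
  edge_inj {u w} h := hi.comp (fun s _ t _ hst => by
    have := congr_fun hst w
    simpa [h.ne'] using this) fun t ht => mem_graphRealization_of_adj h ht
  edge_symm u w t := by rw [sub_sub_cancel, add_comm]
  vert_inj u w h := by
    have := congr_fun (hi ⟨u, u, .inl rfl, left_mem_segment _ _ _⟩
      ⟨w, w, .inl rfl, left_mem_segment _ _ _⟩ h) u
    by_contra hne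
    simp [hne] at this
  vert_mem u := hY ▸ ⟨_, ⟨u, u, .inl rfl, left_mem_segment _ _ _⟩, rfl⟩
  edge_mem h ht := hY ▸ ⟨_, mem_graphRealization_of_adj h ht, rfl⟩
  cover {z} hz := by
    rw [← hY] at hz
    obtain ⟨p, ⟨a, b, hab, hp⟩, rfl⟩ := hz
    rw [segment_eq_image] at hp
    obtain ⟨t, ht, rfl⟩ := hp
    rcases hab with rfl | hab
    · exact .inl ⟨a, by simp [← add_smul]⟩
    rcases ht.1.eq_or_lt with rfl | h0
    · exact .inl ⟨a, by simp⟩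
    rcases ht.2.eq_or_lt with rfl | h1
    · exact .inl ⟨b, by simp⟩
    · exact .inr ⟨a, b, hab, t, ⟨h0, h1⟩, rfl⟩
  edge_ne_vert {u w t k} h ht he := by
    have := hi (mem_graphRealization_of_adj h (Set.Ioo_subset_Icc_self ht))
      ⟨k, k, .inl rfl, left_mem_segment _ _ _⟩ he
    have hk : ∀ l, l = u ∨ l = w → l = k := by
      intro l hl
      rw [← edgePoint_ne_zero_iff h.ne ht, this] at hl
      by_contra hlk
      exact hl (by simp [hlk])
    exact h.ne ((hk u (.inl rfl)).trans (hk w (.inr rfl)).symm)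
  edge_eq_edge {u w u' w' t t'} h h' ht ht' he := by
    have := hi (mem_graphRealization_of_adj h (Set.Ioo_subset_Icc_self ht))
      (mem_graphRealization_of_adj h' (Set.Ioo_subset_Icc_self ht')) he
    have hk : ∀ l, l = u ∨ l = w → l = u' ∨ l = w' := by
      intro l hl
      rwa [← edgePoint_ne_zero_iff h.ne ht, this, edgePoint_ne_zero_iff h'.ne ht'] at hl
    have hne := h.ne
    rcases hk u (.inl rfl) with rfl | rfl
    · rcases hk w (.inr rfl) with rfl | rfl
      · exact absurd rfl hne
      · exact .inl ⟨rfl, rfl⟩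
    · rcases hk w (.inr rfl) with rfl | rfl
      · exact .inr ⟨rfl, rfl⟩
      · exact absurd rfl hne

theorem exists_graphChart {X W : Type*} [TopologicalSpace X] [DecidableEq W] {Y : Set X}
    {H : SimpleGraph W} (h : graphRealization H ≃ₜ Y) (x₀ : X) : Nonempty (GraphChart Y H) := by
  classical
  let φ : (W → ℝ) → X := fun p => if hp : p ∈ graphRealization H then h ⟨p, hp⟩ else x₀
  have hφ : ∀ p : graphRealization H, φ p = h p := fun p => dif_pos p.2
  refine ⟨GraphChart.ofRealization (φ := φ) ?_ ?_ ?_⟩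
  · rw [continuousOn_iff_continuous_domRestrict]
    exact (continuous_subtype_val.comp h.continuous).congr fun p => (hφ p).symm
  · intro p hp q hq hpq
    have := (hφ ⟨p, hp⟩).symm.trans (hpq.trans (hφ ⟨q, hq⟩))
    exact congr_arg Subtype.val (h.injective (Subtype.ext this))
  · ext y
    constructor
    · rintro ⟨p, hp, rfl⟩
      rw [hφ ⟨p, hp⟩]
      exact (h _).2
    · intro hy
      refine ⟨h.symm ⟨y, hy⟩, (h.symm ⟨y, hy⟩).2, ?_⟩
      rw [hφ, h.apply_symm_apply]

/-- In a `3`-connected graph no two vertices separate. -/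
theorem exists_adj_of_hasDisjointPaths {W : Type*} {H : SimpleGraph W} {x y p q : W}
    (h : HasDisjointPaths H 3 x y) {U : Set W} (hx : x ∈ U) (hy : y ∉ U) (hxp : x ≠ p)
    (hxq : x ≠ q) (hyp : y ≠ p) (hyq : y ≠ q) :
    ∃ a b, H.Adj a b ∧ a ∈ U ∧ b ∉ U ∧ a ≠ p ∧ a ≠ q ∧ b ≠ p ∧ b ≠ q := by
  obtain ⟨γ, -, hγ⟩ := h
  have key : ∀ z, x ≠ z → y ≠ z → ∀ i j, z ∈ (γ i).1.support → z ∈ (γ j).1.support → i = j := by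
    intro z hx hy i j hi hj
    by_contra hij
    rcases hγ i j hij z hi hj with rfl | rfl
    · exact hx rfl
    · exact hy rfl
  -- Each of p and q lies on at most one of the three paths, so one path misses both; it must leave
  -- U along some edge.
  obtain ⟨i, hip, hiq⟩ : ∃ i, p ∉ (γ i).1.support ∧ q ∉ (γ i).1.support := by
    by_contra! hcon
    have kp := key p hxp hyp
    have kq := key q hxq hyq
    by_cases h0 : p ∈ (γ 0).1.support
    · have h1 : p ∉ (γ 1).1.support := fun h => absurd (kp _ _ h0 h) (by decide)
      have h2 : p ∉ (γ 2).1.support := fun h => absurd (kp _ _ h0 h) (by decide)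
      exact absurd (kq _ _ (hcon 1 h1) (hcon 2 h2)) (by decide)
    · have q0 := hcon 0 h0
      by_cases h1 : p ∈ (γ 1).1.support
      · have h2 : p ∉ (γ 2).1.support := fun h => absurd (kp _ _ h1 h) (by decide)
        exact absurd (kq _ _ q0 (hcon 2 h2)) (by decide)
      · exact absurd (kq _ _ q0 (hcon 1 h1)) (by decide)
  obtain ⟨d, hd, hd1, hd2⟩ := (γ i).1.exists_boundary_dart U hx hy
  have f1 := (γ i).1.dart_fst_mem_support_of_mem_darts hd
  have f2 := (γ i).1.dart_snd_mem_support_of_mem_darts hd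
  exact ⟨d.fst, d.snd, d.adj, hd1, hd2, by rintro rfl; exact hip f1, by rintro rfl; exact hiq f1,
    by rintro rfl; exact hip f2, by rintro rfl; exact hiq f2⟩

/-! ### Loops and bridges -/

/-- The point of the loop `S` with real parameter `t`. -/
def loopAt {X : Type*} [TopologicalSpace X] (S : C(AddCircle (1 : ℝ), X)) (t : ℝ) : X :=
  S (t : AddCircle (1 : ℝ))

section Loop

variable {X : Type*} [TopologicalSpace X] {S : C(AddCircle (1 : ℝ), X)}

theorem continuous_loopAt : Continuous (loopAt S) :=
  S.continuous.comp (AddCircle.continuous_mk' 1)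

theorem loopAt_mem_range (t : ℝ) : loopAt S t ∈ Set.range S := ⟨_, rfl⟩

theorem loopAt_add_intCast (t : ℝ) (n : ℤ) : loopAt S (t + n) = loopAt S t := by
  have : ((n : ℝ) : AddCircle (1 : ℝ)) = 0 := (AddCircle.coe_eq_zero_iff 1).2 ⟨n, by simp⟩
  rw [loopAt, AddCircle.coe_add, this, add_zero, loopAt]

theorem loopAt_add_one (t : ℝ) : loopAt S (t + 1) = loopAt S t := by
  simpa using loopAt_add_intCast (S := S) t 1

theorem loopAt_eq_iff (hS : Function.Injective S) {s t : ℝ} :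
    loopAt S s = loopAt S t ↔ ∃ n : ℤ, t = s + n := by
  constructor
  · intro h
    have h1 : ((t - s : ℝ) : AddCircle (1 : ℝ)) = 0 := by
      rw [AddCircle.coe_sub, hS h, sub_self]
    obtain ⟨n, hn⟩ := (AddCircle.coe_eq_zero_iff (1 : ℝ)).1 h1
    exact ⟨n, by simp at hn; linarith⟩
  · rintro ⟨n, rfl⟩
    exact (loopAt_add_intCast s n).symm

theorem eq_or_eq_add_one_of_loopAt_eq (hS : Function.Injective S) {s t : ℝ}
    (h : loopAt S s = loopAt S t) (h1 : s ≤ t) (h2 : t ≤ s + 1) : t = s ∨ t = s + 1 := by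
  obtain ⟨n, rfl⟩ := (loopAt_eq_iff hS).1 h
  have a1 : (0 : ℝ) ≤ n := by linarith
  have a2 : (n : ℝ) ≤ 1 := by linarith
  have b1 : 0 ≤ n := by exact_mod_cast a1
  have b2 : n ≤ 1 := by exact_mod_cast a2
  obtain rfl | rfl : n = 0 ∨ n = 1 := by omega
  · left; simp
  · right; simp

theorem loopAt_ne (hS : Function.Injective S) {s t : ℝ} (h1 : s < t) (h2 : t < s + 1) :
    loopAt S s ≠ loopAt S t := by
  intro h
  rcases eq_or_eq_add_one_of_loopAt_eq hS h h1.le h2.le with h | h <;> linarith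

theorem exists_loopAt_eq {x : X} (hx : x ∈ Set.range S) (a : ℝ) :
    ∃ t, a ≤ t ∧ t < a + 1 ∧ loopAt S t = x := by
  obtain ⟨s, rfl⟩ := hx
  obtain ⟨r, rfl⟩ := QuotientAddGroup.mk_surjective s
  refine ⟨r + (-⌊r - a⌋ : ℤ), ?_, ?_, loopAt_add_intCast _ _⟩
  · push_cast; linarith [Int.floor_le (r - a)]
  · push_cast; linarith [Int.lt_floor_add_one (r - a)]

theorem disjoint_loopAt_image (hS : Function.Injective S) {A B : Set ℝ}
    (h : ∀ s ∈ A, ∀ t ∈ B, s < t ∧ t < s + 1) : Disjoint (loopAt S '' A) (loopAt S '' B) := by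
  rw [Set.disjoint_left]
  rintro _ ⟨s, hs, rfl⟩ ⟨t, ht, hst⟩
  exact loopAt_ne hS (h s hs t ht).1 (h s hs t ht).2 hst.symm

theorem joinedIn_loopAt {s t : ℝ} (h : s ≤ t) :
    JoinedIn (loopAt S '' Set.Icc s t) (loopAt S s) (loopAt S t) :=
  ((convex_Icc s t).isPathConnected ⟨s, by simpa⟩ |>.image continuous_loopAt).joinedIn _
    ⟨s, by simpa, rfl⟩ _ ⟨t, by simpa, rfl⟩

/-- A connected part of a loop that avoids two points lies on one side of them. -/
theorem not_both_sides_of_isPreconnected [T2Space X] (hS : Function.Injective S) {J : Set X}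
    (hJ : IsPreconnected J) (hJS : J ⊆ Set.range S) {p q : ℝ}
    (hp : loopAt S p ∉ J) (hq : loopAt S q ∉ J) {a b : X} (ha : a ∈ J) (hb : b ∈ J)
    (ha' : a ∈ loopAt S '' Set.Ioo p q) (hb' : b ∈ loopAt S '' Set.Ioo q (p + 1)) : False := by
  have hcl : ∀ s t, IsClosed (loopAt S '' Set.Icc s t) := fun s t =>
    (isCompact_Icc.image continuous_loopAt).isClosed
  have hcov : J ⊆ loopAt S '' Set.Icc p q ∪ loopAt S '' Set.Icc q (p + 1) := by
    intro x hx
    obtain ⟨t, h1, h2, rfl⟩ := exists_loopAt_eq (hJS hx) p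
    rcases le_total t q with h | h
    · exact .inl ⟨t, ⟨h1, h⟩, rfl⟩
    · exact .inr ⟨t, ⟨h, h2.le⟩, rfl⟩
  -- The two closed arcs cover J and meet only in the points with parameters p and q. A connected J
  -- meeting both arcs would contain one of these.
  obtain ⟨x, hx, ⟨s, hs, rfl⟩, t, ht, hst⟩ := isPreconnected_closed_iff.1 hJ _ _ (hcl p q)
    (hcl q (p + 1)) hcov ⟨a, ha, Set.image_mono Set.Ioo_subset_Icc_self ha'⟩
    ⟨b, hb, Set.image_mono Set.Ioo_subset_Icc_self hb'⟩
  rcases eq_or_eq_add_one_of_loopAt_eq hS hst.symm (hs.2.trans ht.1)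
    (by linarith [hs.1, ht.2]) with h | h
  · have : s = q := le_antisymm hs.2 (h ▸ ht.1)
    exact hq (this ▸ hx)
  · have : s = p := le_antisymm (by linarith [ht.2]) hs.1
    exact hp (this ▸ hx)

end Loop

namespace GraphChart

variable {X W : Type*} [TopologicalSpace X] [T2Space X] {Y : Set X} {H : SimpleGraph W}
  {c : GraphChart Y H} {S : C(AddCircle (1 : ℝ), X)}

/-- The piece of the edge up to parameter t is a connected part of the loop that misses both
separating vertices. Taking t < 1 locates interior points of the edge, and t = 1 locates its other
end. -/
theorem edge_not_both_sides (hS : Function.Injective S)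
    {p q : ℝ} {up uq : W} (hup : c.vert up = loopAt S p) (huq : c.vert uq = loopAt S q) {u w : W} (h : H.Adj u w) (hin : c.inner u w ⊆ Set.range S)
    (hu1 : u ≠ up) (hu2 : u ≠ uq) {t : ℝ} (ht : 0 < t) (ht1 : t ≤ 1) (hw1 : t = 1 → w ≠ up)
    (hw2 : t = 1 → w ≠ uq) : (c.vert u ∈ loopAt S '' Set.Ioo p q →
      c.edge u w t ∈ loopAt S '' Set.Ioo q (p + 1) → False) ∧
    (c.vert u ∈ loopAt S '' Set.Ioo q (p + 1) →
      c.edge u w t ∈ loopAt S '' Set.Ioo p q → False) := by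
  have hLc : IsClosed (Set.range S) := (isCompact_range S.continuous).isClosed
  have hsub : Set.Icc 0 t ⊆ Set.Icc 0 1 := Set.Icc_subset_Icc_right ht1
  have hJ : IsPreconnected (c.edge u w '' Set.Icc 0 t) :=
    isPreconnected_Icc.image _ ((c.edge_cont h).mono hsub)
  have hm0 : c.vert u ∈ c.edge u w '' Set.Icc 0 t := ⟨0, by simp [ht.le], c.edge_zero h⟩
  have hm1 : c.edge u w t ∈ c.edge u w '' Set.Icc 0 t := ⟨t, by simp [ht.le], rfl⟩
  have hJS : c.edge u w '' Set.Icc 0 t ⊆ Set.range S := by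
    intro x hx
    rcases c.mem_edge_cases h (Set.image_mono hsub hx) with rfl | rfl | hx
    · exact c.vert_mem_of_inner_subset h hLc hin
    · exact c.vert_mem_of_inner_subset h.symm hLc (c.inner_comm u w ▸ hin)
    · exact hin hx
  have hv : ∀ k, u ≠ k → (t = 1 → w ≠ k) → c.vert k ∉ c.edge u w '' Set.Icc 0 t := by
    rintro k h1 h2 ⟨s, hs, hsk⟩
    rcases hs.1.eq_or_lt with rfl | hs0
    · exact h1 (c.vert_inj ((c.edge_zero h).symm.trans hsk))
    rcases (hs.2.trans ht1).eq_or_lt with rfl | hs1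
    · exact h2 (le_antisymm ht1 hs.2) (c.vert_inj ((c.edge_one h).symm.trans hsk))
    · exact c.edge_ne_vert h ⟨hs0, hs1⟩ hsk
  have hp := hup ▸ hv up hu1 hw1
  have hq := huq ▸ hv uq hu2 hw2
  exact ⟨fun ha hb => not_both_sides_of_isPreconnected hS hJ hJS hp hq hm0 hm1 ha hb,
    fun ha hb => not_both_sides_of_isPreconnected hS hJ hJS hp hq hm1 hm0 hb ha⟩

variable [Finite W]

/-- An arc of a loop together with a component attached to its closure only contains an inner
vertex. -/
theorem exists_vert_side (hS : Function.Injective S) (hSY : Set.range S ⊆ Y)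
    {p q : ℝ} (hpq : p < q) (hqp : q < p + 1) {up uq : W} (hup : c.vert up = loopAt S p)
    (huq : c.vert uq = loopAt S q) {z : X} (hz : z ∈ Y \ Set.range S)
    (hC : ∀ t ∈ Set.Ioo q (p + 1),
      ¬ Attaches (connectedComponentIn (Y \ Set.range S) z) (loopAt S t)) :
    ∃ u, c.vert u ∈ loopAt S '' Set.Ioo p q ∨
      c.vert u ∈ connectedComponentIn (Y \ Set.range S) z := by
  by_contra! hcon
  have hL : c.Saturates (Set.range S) := fun u w h => c.inner_subset_or_disjoint hS hSY h
  have hLc : IsClosed (Set.range S) := (isCompact_range S.continuous).isClosed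
  -- With no vertex available inside the arc or the component, an edge through z can only end at the
  -- two separating vertices.
  have hends : ∀ u w, H.Adj u w → z ∈ c.inner u w → u = up ∨ u = uq := by
    intro u w h hzu
    have hatt := hL.attaches_vert h hzu hz.2
    by_cases huL : c.vert u ∈ Set.range S
    · obtain ⟨t, h1, h2, ht⟩ := exists_loopAt_eq huL p
      rcases h1.eq_or_lt with rfl | h1
      · exact .inl (c.vert_inj (ht.symm.trans hup.symm))
      rcases lt_trichotomy t q with h3 | rfl | h3
      · exact absurd ⟨t, ⟨h1, h3⟩, ht⟩ (hcon u).1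
      · exact .inr (c.vert_inj (ht.symm.trans huq.symm))
      · exact absurd (ht ▸ hatt) (hC t ⟨h3, h2⟩)
    · exact absurd (hL.vert_component h hzu hz.2 huL) (hcon u).2
  obtain ⟨u, w, h, hzu⟩ : ∃ u w, H.Adj u w ∧ z ∈ c.inner u w := by
    rcases c.cover hz.1 with ⟨u, rfl⟩ | ⟨u, w, h, hzu⟩
    · exact absurd (mem_connectedComponentIn hz) (hcon u).2
    · exact ⟨u, w, h, hzu⟩
  have hm : loopAt S ((p + q) / 2) ∈ loopAt S '' Set.Ioo p q :=
    ⟨_, ⟨by linarith, by linarith⟩, rfl⟩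
  obtain ⟨u', w', h', hmu⟩ :
      ∃ u w, H.Adj u w ∧ loopAt S ((p + q) / 2) ∈ c.inner u w := by
    rcases c.cover (hSY (loopAt_mem_range ((p + q) / 2))) with ⟨u, hu⟩ | ⟨u, w, h, hzu⟩
    · exact absurd (hu ▸ hm) (hcon u).1
    · exact ⟨u, w, h, hzu⟩
  have hends' : ∀ u w, H.Adj u w → loopAt S ((p + q) / 2) ∈ c.inner u w → u = up ∨ u = uq := by
    intro u w h hmu
    by_contra! hne
    have hin := (hL u w h).resolve_right
      (Set.not_disjoint_iff.2 ⟨_, hmu, loopAt_mem_range _⟩)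
    have huS := c.vert_mem_of_inner_subset h hLc hin
    obtain ⟨r, hr, hr'⟩ := hmu
    refine (c.edge_not_both_sides hS hup huq h hin hne.1 hne.2 hr.1 hr.2.le
      (fun h => absurd h hr.2.ne) (fun h => absurd h hr.2.ne)).2 ?_ (hr' ▸ hm)
    obtain ⟨t, h1, h2, ht⟩ := exists_loopAt_eq huS p
    rcases h1.eq_or_lt with rfl | h1
    · exact absurd (c.vert_inj (ht.symm.trans hup.symm)) hne.1
    rcases lt_trichotomy t q with h3 | rfl | h3
    · exact absurd ⟨t, ⟨h1, h3⟩, ht⟩ (hcon u).1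
    · exact absurd (c.vert_inj (ht.symm.trans huq.symm)) hne.2
    · exact ⟨t, ⟨h3, h2⟩, ht⟩
  have e1 := hends u w h hzu
  have e2 := hends w u h.symm (c.inner_comm u w ▸ hzu)
  have e3 := hends' u' w' h' hmu
  have e4 := hends' w' u' h'.symm (c.inner_comm u' w' ▸ hmu)
  have hin := (hL u' w' h').resolve_right
      (Set.not_disjoint_iff.2 ⟨_, hmu, loopAt_mem_range _⟩)
  have hne := h.ne
  have hne' := h'.ne
  -- The edge through z and the edge through the midpoint of the arc have the same two ends. In a
  -- simple graph they are equal, although one lies on the loop and the other does not.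
  have : u = u' ∧ w = w' ∨ u = w' ∧ w = u' := by grind
  rcases this with ⟨rfl, rfl⟩ | ⟨rfl, rfl⟩
  · exact hz.2 (hin hzu)
  · exact hz.2 (hin (c.inner_comm u w ▸ hzu))

/-- If two components of the complement of a loop are attached on different sides of two vertices
of the loop, then some component is attached on both sides. -/
theorem exists_bridge (hS : Function.Injective S) (hSY : Set.range S ⊆ Y)
    (h3 : ∀ x y : W, x ≠ y → HasDisjointPaths H 3 x y)
    {p q : ℝ} (hpq : p < q) (hqp : q < p + 1) {up uq : W} (hup : c.vert up = loopAt S p)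
    (huq : c.vert uq = loopAt S q) {z z' : X} (hz : z ∈ Y \ Set.range S)
    (hz' : z' ∈ Y \ Set.range S)
    (hC : ∀ t ∈ Set.Ioo p q,
      ¬ Attaches (connectedComponentIn (Y \ Set.range S) z) (loopAt S t))
    (hC' : ∀ t ∈ Set.Ioo q (p + 1),
      ¬ Attaches (connectedComponentIn (Y \ Set.range S) z') (loopAt S t))
    (hne : z' ∉ connectedComponentIn (Y \ Set.range S) z) :
    ∃ y ∈ Y \ Set.range S, ∃ s ∈ Set.Ioo p q, ∃ t ∈ Set.Ioo q (p + 1),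
      Attaches (connectedComponentIn (Y \ Set.range S) y) (loopAt S s) ∧
      Attaches (connectedComponentIn (Y \ Set.range S) y) (loopAt S t) := by
  by_contra! hcon
  have hL : c.Saturates (Set.range S) := fun u w h => c.inner_subset_or_disjoint hS hSY h
  have hLc : IsClosed (Set.range S) := (isCompact_range S.continuous).isClosed
  let K := connectedComponentIn (Y \ Set.range S)
  have hKsub : ∀ {y x}, x ∈ K y → x ∈ Y \ Set.range S := fun h => connectedComponentIn_subset _ _ h
  have hKeq : ∀ {y x}, x ∈ K y → K y = K x := fun h => connectedComponentIn_eq h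
  have hKself : ∀ {y}, y ∈ Y \ Set.range S → y ∈ K y := fun h => mem_connectedComponentIn h
  -- U collects the vertices on the side (p, q). The component of z' is included outright, since it
  -- may have no foot strictly between p and q.
  let U : Set W := {u | c.vert u ∈ loopAt S '' Set.Ioo p q ∨ c.vert u ∉ Set.range S ∧
    ((∃ s ∈ Set.Ioo p q, Attaches (K (c.vert u)) (loopAt S s)) ∨ c.vert u ∈ K z')}
  have hdisj : ∀ x, x ∈ loopAt S '' Set.Ioo p q → x ∈ loopAt S '' Set.Ioo q (p + 1) → False := by
    refine fun x h1 h2 => Set.disjoint_left.1 (disjoint_loopAt_image hS fun s hs t ht => ?_) h1 h2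
    exact ⟨hs.2.trans ht.1, by linarith [hs.1, ht.2]⟩
  obtain ⟨x, hx⟩ := c.exists_vert_side hS hSY hpq hqp hup huq hz' hC'
  -- The same argument for z on the complementary arc, which is read from q to p + 1.
  obtain ⟨y, hy⟩ := c.exists_vert_side (p := q) (q := p + 1) hS hSY hqp (by linarith) huq
    (hup.trans (loopAt_add_one p).symm) hz (by
      intro t ht h
      refine hC (t - 1) ⟨by linarith [ht.1], by linarith [ht.2]⟩ ?_
      rwa [← loopAt_add_one, sub_add_cancel])
  have hnp : ∀ k, c.vert k ∈ loopAt S '' Set.Ioo p q ∨ c.vert k ∈ loopAt S '' Set.Ioo q (p + 1) ∨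
      c.vert k ∉ Set.range S → k ≠ up ∧ k ≠ uq := by
    intro k hk
    constructor
    · rintro rfl
      rw [hup] at hk
      rcases hk with ⟨t, ht, h⟩ | ⟨t, ht, h⟩ | hk
      · exact loopAt_ne hS ht.1 (by linarith [ht.2]) h.symm
      · exact loopAt_ne hS (by linarith [ht.1]) ht.2 h.symm
      · exact hk (loopAt_mem_range _)
    · rintro rfl
      rw [huq] at hk
      rcases hk with ⟨t, ht, h⟩ | ⟨t, ht, h⟩ | hk
      · exact loopAt_ne hS ht.2 (by linarith [ht.1]) h
      · exact loopAt_ne hS ht.1 (by linarith [ht.2]) h.symm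
      · exact hk (loopAt_mem_range _)
  have hxU : x ∈ U := hx.imp id fun h => ⟨(hKsub h).2, .inr h⟩
  have hyU : y ∉ U := by
    rintro (h | ⟨h, h'⟩)
    · rcases hy with hy | hy
      · exact hdisj _ h hy
      · obtain ⟨t, -, ht⟩ := h
        exact (hKsub hy).2 (ht ▸ loopAt_mem_range t)
    · rcases hy with ⟨t, -, ht⟩ | hy
      · exact h (ht ▸ loopAt_mem_range t)
      · rcases h' with ⟨s, hs, h'⟩ | h'
        · rw [← hKeq hy] at h'
          exact hC s hs h'
        · refine hne ?_
          change z' ∈ K z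
          rw [hKeq hy, ← hKeq h']
          exact hKself hz'
  have hxn := hnp x (hx.imp id fun h => .inr (hKsub h).2)
  have hyn := hnp y (.inr (hy.imp id fun h => (hKsub h).2))
  have hxy : x ≠ y := by rintro rfl; exact hyU hxU
  obtain ⟨a, b, hab, ha, hb, hap, haq, hbp, hbq⟩ := exists_adj_of_hasDisjointPaths (h3 x y hxy)
    hxU hyU hxn.1 hxn.2 hyn.1 hyn.2
  have hside : ∀ k, k ≠ up → k ≠ uq → k ∉ U → c.vert k ∈ Set.range S →
      c.vert k ∈ loopAt S '' Set.Ioo q (p + 1) := by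
    intro k hk1 hk2 hkU hkS
    obtain ⟨t, h1, h2, ht⟩ := exists_loopAt_eq hkS p
    rcases h1.eq_or_lt with rfl | h1
    · exact absurd (c.vert_inj (ht.symm.trans hup.symm)) hk1
    rcases lt_trichotomy t q with h3 | rfl | h3
    · exact absurd (.inl ⟨t, ⟨h1, h3⟩, ht⟩) hkU
    · exact absurd (c.vert_inj (ht.symm.trans huq.symm)) hk2
    · exact ⟨t, ⟨h3, h2⟩, ht⟩
  -- An edge leaving U away from p and q is impossible: on the loop it would cross from one side to
  -- the other, and off the loop its component would be a bridge or would give the component of z' a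
  -- forbidden foot.
  rcases hL a b hab with hin | hd
  · have haS := c.vert_mem_of_inner_subset hab hLc hin
    have hbS := c.vert_mem_of_inner_subset hab.symm hLc (c.inner_comm a b ▸ hin)
    have haA := ha.resolve_right fun h => h.1 haS
    refine (c.edge_not_both_sides hS hup huq hab hin hap haq one_pos le_rfl
      (fun _ => hbp) (fun _ => hbq)).1 haA ?_
    rw [c.edge_one hab]
    exact hside b hbp hbq hb hbS
  · obtain ⟨m, hm⟩ := c.inner_nonempty a b
    have hmL := Set.disjoint_left.1 hd hm
    have hm' : m ∈ c.inner b a := c.inner_comm a b ▸ hm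
    have hmY : m ∈ Y \ Set.range S := ⟨c.inner_subset hab hm, hmL⟩
    have hatt_a : Attaches (K m) (c.vert a) := hL.attaches_vert hab hm hmL
    have hatt_b : Attaches (K m) (c.vert b) := hL.attaches_vert hab.symm hm' hmL
    have hKm : (∃ s ∈ Set.Ioo p q, Attaches (K m) (loopAt S s)) ∨ K m = K z' := by
      rcases ha with ⟨s, hs, hsa⟩ | ⟨haS, ha⟩
      · exact .inl ⟨s, hs, hsa ▸ hatt_a⟩
      · have : K m = K (c.vert a) := hKeq (hL.vert_component hab hm hmL haS)
        rw [this]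
        exact ha.imp id fun h => (hKeq h).symm
    by_cases hbS : c.vert b ∈ Set.range S
    · obtain ⟨t, ht, htb⟩ := hside b hbp hbq hb hbS
      rcases hKm with ⟨s, hs, h⟩ | h
      · exact hcon m hmY s hs t ht h (htb ▸ hatt_b)
      · rw [h, ← htb] at hatt_b
        exact hC' t ht hatt_b
    · have hbK := hL.vert_component hab.symm hm' hmL hbS
      refine hb (.inr ⟨hbS, ?_⟩)
      rw [← hKeq hbK]
      refine hKm.imp id fun h => ?_
      rw [← h]
      exact hbK

end GraphChart

/-! ### Forbidden configurations around a planar loop -/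

theorem not_drawing_K33_of_sets {X : Type*} [TopologicalSpace X] {f : X → ℂ} (hf : Continuous f)
    (hinj : Function.Injective f) {a0 a1 a2 b0 b1 b2 : X}
    {F00 F01 F02 F10 F11 F12 F20 F21 F22 : Set X}
    (j00 : JoinedIn F00 a0 b0) (j01 : JoinedIn F01 a0 b1) (j02 : JoinedIn F02 a0 b2)
    (j10 : JoinedIn F10 a1 b0) (j11 : JoinedIn F11 a1 b1) (j12 : JoinedIn F12 a1 b2)
    (j20 : JoinedIn F20 a2 b0) (j21 : JoinedIn F21 a2 b1) (j22 : JoinedIn F22 a2 b2)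
    (d0011 : Disjoint F00 F11) (d0012 : Disjoint F00 F12)
    (d0110 : Disjoint F01 F10) (d0112 : Disjoint F01 F12)
    (d0210 : Disjoint F02 F10) (d0211 : Disjoint F02 F11)
    (d0021 : Disjoint F00 F21) (d0022 : Disjoint F00 F22)
    (d0120 : Disjoint F01 F20) (d0122 : Disjoint F01 F22)
    (d0220 : Disjoint F02 F20) (d0221 : Disjoint F02 F21)
    (d1021 : Disjoint F10 F21) (d1022 : Disjoint F10 F22)
    (d1120 : Disjoint F11 F20) (d1122 : Disjoint F11 F22)
    (d1220 : Disjoint F12 F20) (d1221 : Disjoint F12 F21) : False := by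
  refine not_drawing_K33 hf hinj ![a0, a1, a2] ![b0, b1, b2]
    ![![F00, F01, F02], ![F10, F11, F12], ![F20, F21, F22]] ?_ ?_
  · intro i j
    fin_cases i <;> fin_cases j <;> assumption
  · intro i i' j j' hi hj
    fin_cases i <;> fin_cases i' <;> first | exact absurd hi (by decide) | skip
    all_goals fin_cases j <;> fin_cases j' <;> first | exact absurd rfl hj | assumption

section Loop

variable {X : Type*} [TopologicalSpace X] {S : C(AddCircle (1 : ℝ), X)}

theorem disjoint_loopAt_Icc (hS : Function.Injective S) {s t s' t' : ℝ} (h : t < s')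
    (h' : t' < s + 1) : Disjoint (loopAt S '' Set.Icc s t) (loopAt S '' Set.Icc s' t') :=
  disjoint_loopAt_image hS fun _ hx _ hy =>
    ⟨hx.2.trans_lt (h.trans_le hy.1), by linarith [hx.1, hy.2]⟩

theorem loopAt_notMem_Icc (hS : Function.Injective S) {s t p : ℝ} (h : t < p) (h' : p < s + 1) :
    loopAt S p ∉ loopAt S '' Set.Icc s t := by
  rintro ⟨x, hx, hxp⟩
  exact loopAt_ne hS (hx.2.trans_lt h) (by linarith [hx.1]) hxp

theorem loopAt_notMem_Icc' (hS : Function.Injective S) {s t p : ℝ} (h : p < s) (h' : t < p + 1) :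
    loopAt S p ∉ loopAt S '' Set.Icc s t := by
  rintro ⟨x, hx, hxp⟩
  exact loopAt_ne hS (h.trans_le hx.1) (by linarith [hx.2]) hxp.symm

theorem disjoint_insert_loopAt {C : Set X} (hC : Disjoint C (Set.range S)) {p : X} {A : Set ℝ}
    (hp : p ∉ loopAt S '' A) : Disjoint (insert p C) (loopAt S '' A) := by
  rw [Set.disjoint_insert_left]
  exact ⟨hp, hC.mono_right (by rintro _ ⟨t, -, rfl⟩; exact loopAt_mem_range t)⟩

theorem disjoint_insert_insert {C C' : Set X} (hC : Disjoint C (Set.range S))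
    (hC' : Disjoint C' (Set.range S)) (h : Disjoint C C') {p q : ℝ}
    (hpq : loopAt S p ≠ loopAt S q) : Disjoint (insert (loopAt S p) C) (insert (loopAt S q) C') := by
  rw [Set.disjoint_insert_left, Set.disjoint_insert_right]
  refine ⟨?_, fun hq => Set.disjoint_left.1 hC hq (loopAt_mem_range q), h⟩
  rintro (h | h)
  · exact hpq h
  · exact Set.disjoint_left.1 hC' h (loopAt_mem_range p)

theorem joinedIn_loopAt_turn {s t : ℝ} (h : s ≤ t + 1) :
    JoinedIn (loopAt S '' Set.Icc s (t + 1)) (loopAt S s) (loopAt S t) := by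
  rw [← loopAt_add_one (S := S) t]
  exact joinedIn_loopAt h

/-- Two crossing bridges of a planar loop cannot be joined off the loop. -/
theorem not_crossing_of_joinedIn {f : X → ℂ} (hf : Continuous f) (hinj : Function.Injective f)
    (hS : Function.Injective S) {C C' E : Set X} {v v' : X} (hC : Disjoint C (Set.range S))
    (hC' : Disjoint C' (Set.range S)) (hE : Disjoint E (Set.range S)) (hCC' : Disjoint C C')
    (hv : JoinedIn E v v') {p p' q q' : ℝ} (h1 : p < p') (h2 : p' < q) (h3 : q < q')
    (h4 : q' < p + 1)
    (hp : JoinedIn (insert (loopAt S p) C) v (loopAt S p))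
    (hq : JoinedIn (insert (loopAt S q) C) v (loopAt S q))
    (hp' : JoinedIn (insert (loopAt S p') C') v' (loopAt S p'))
    (hq' : JoinedIn (insert (loopAt S q') C') v' (loopAt S q')) : False := by
  have hEs : ∀ A, Disjoint E (loopAt S '' A) := fun A =>
    hE.mono_right (by rintro _ ⟨t, -, rfl⟩; exact loopAt_mem_range t)
  -- The parts are {v, p', q'} and {v', p, q}. The edges not at v or v' are the four arcs of the
  -- loop between consecutive points.
  exact not_drawing_K33_of_sets hf hinj (a0 := v) (a1 := loopAt S p') (a2 := loopAt S q')
    (b0 := v') (b1 := loopAt S p) (b2 := loopAt S q)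
    hv hp hq hp'.symm (joinedIn_loopAt h1.le).symm (joinedIn_loopAt h2.le)
    hq'.symm (joinedIn_loopAt_turn h4.le) (joinedIn_loopAt h3.le).symm
    (hEs _) (hEs _)
    (disjoint_insert_insert hC hC' hCC' (loopAt_ne hS h1 (by linarith)))
    (disjoint_insert_loopAt hC (loopAt_notMem_Icc' hS h1 (by linarith)))
    (disjoint_insert_insert hC hC' hCC' (loopAt_ne hS h2 (by linarith)).symm)
    (disjoint_insert_loopAt hC (loopAt_notMem_Icc hS h2 (by linarith)))
    (hEs _) (hEs _)
    (disjoint_insert_insert hC hC' hCC' (loopAt_ne hS (by linarith) (by linarith)))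
    (disjoint_insert_loopAt hC (loopAt_notMem_Icc' hS (by linarith) (by linarith)))
    (disjoint_insert_insert hC hC' hCC' (loopAt_ne hS h3 (by linarith)))
    (disjoint_insert_loopAt hC (loopAt_notMem_Icc' hS h3 (by linarith)))
    (disjoint_insert_loopAt hC' (loopAt_notMem_Icc' hS (by linarith) (by linarith)))
    (disjoint_insert_loopAt hC' (loopAt_notMem_Icc' hS (by linarith) (by linarith)))
    (disjoint_insert_loopAt hC' (loopAt_notMem_Icc hS (by linarith) (by linarith))).symm
    (disjoint_loopAt_Icc hS h2 (by linarith))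
    (disjoint_insert_loopAt hC' (loopAt_notMem_Icc hS (by linarith) (by linarith))).symm
    (disjoint_loopAt_Icc hS (by linarith) (by linarith))

/-- Three pairwise overlapping bridges of a planar loop cannot exist. -/
theorem not_three_bridges {f : X → ℂ} (hf : Continuous f) (hinj : Function.Injective f)
    (hS : Function.Injective S) {M K K' : Set X} {m : X} (hM : Disjoint M (Set.range S))
    (hK : Disjoint K (Set.range S)) (hK' : Disjoint K' (Set.range S)) (hMK : Disjoint M K)
    (hMK' : Disjoint M K') (hKK' : Disjoint K K') {x y a b z : ℝ} (h1 : x < y) (h2 : y < b)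
    (h3 : b < z) (h4 : z < a) (h5 : a < x + 1)
    (hx : JoinedIn (insert (loopAt S x) M) m (loopAt S x))
    (hy : JoinedIn (insert (loopAt S y) M) m (loopAt S y))
    (hz : JoinedIn (insert (loopAt S z) M) m (loopAt S z))
    (hay : JoinedIn (insert (loopAt S a) (insert (loopAt S y) K)) (loopAt S a) (loopAt S y))
    (hbx : JoinedIn (insert (loopAt S b) (insert (loopAt S x) K')) (loopAt S b) (loopAt S x)) :
    False := by
  have hne : ∀ {s t}, x ≤ s → s < t → t < x + 1 → loopAt S s ≠ loopAt S t :=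
    fun h h' h'' => loopAt_ne hS h' (by linarith)
  have d3 : Disjoint (insert (loopAt S a) (insert (loopAt S y) K))
      (insert (loopAt S b) (insert (loopAt S x) K')) := by
    have := disjoint_insert_insert hK hK' hKK' (hne le_rfl h1 (by linarith)).symm
    rw [Set.disjoint_insert_left, Set.disjoint_insert_right]
    refine ⟨?_, ?_, this⟩
    · rintro (h | h | h)
      · exact hne (by linarith) (by linarith) h5 h.symm
      · exact hne le_rfl (by linarith) h5 h.symm
      · exact Set.disjoint_left.1 hK' h (loopAt_mem_range _)
    · rintro (h | h)
      · exact hne h1.le h2 (by linarith) h.symm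
      · exact Set.disjoint_left.1 hK h (loopAt_mem_range _)
  have dK : ∀ {s}, loopAt S s ≠ loopAt S a → loopAt S s ≠ loopAt S y →
      Disjoint (insert (loopAt S a) (insert (loopAt S y) K)) (insert (loopAt S s) M) := by
    intro s hs hs'
    rw [Set.disjoint_insert_left]
    refine ⟨?_, disjoint_insert_insert hK hM hMK.symm hs'.symm⟩
    rintro (h | h)
    · exact hs h.symm
    · exact Set.disjoint_left.1 hM h (loopAt_mem_range _)
  have dK' : ∀ {s}, loopAt S s ≠ loopAt S b → loopAt S s ≠ loopAt S x →
      Disjoint (insert (loopAt S b) (insert (loopAt S x) K')) (insert (loopAt S s) M) := by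
    intro s hs hs'
    rw [Set.disjoint_insert_left]
    refine ⟨?_, disjoint_insert_insert hK' hM hMK'.symm hs'.symm⟩
    rintro (h | h)
    · exact hs h.symm
    · exact Set.disjoint_left.1 hM h (loopAt_mem_range _)
  have dKA : ∀ {A}, loopAt S a ∉ loopAt S '' A → loopAt S y ∉ loopAt S '' A →
      Disjoint (insert (loopAt S a) (insert (loopAt S y) K)) (loopAt S '' A) := fun h h' =>
    Set.disjoint_insert_left.2 ⟨h, disjoint_insert_loopAt hK h'⟩
  have dKA' : ∀ {A}, loopAt S b ∉ loopAt S '' A → loopAt S x ∉ loopAt S '' A →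
      Disjoint (insert (loopAt S b) (insert (loopAt S x) K')) (loopAt S '' A) := fun h h' =>
    Set.disjoint_insert_left.2 ⟨h, disjoint_insert_loopAt hK' h'⟩
  -- The parts are {a, b, m} and {x, y, z}. The set M joins m to x, y and z, the set K joins a to y,
  -- and K' joins b to x; the other four edges are arcs of the loop.
  exact not_drawing_K33_of_sets hf hinj (a0 := loopAt S a) (a1 := loopAt S b) (a2 := m)
    (b0 := loopAt S x) (b1 := loopAt S y) (b2 := loopAt S z)
    (joinedIn_loopAt_turn h5.le) hay (joinedIn_loopAt h4.le).symm
    hbx (joinedIn_loopAt h2.le).symm (joinedIn_loopAt h3.le) hx hy hz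
    (disjoint_loopAt_Icc hS (by linarith) (by linarith)).symm
    (disjoint_loopAt_Icc hS (by linarith) (by linarith)).symm
    d3 (dKA (loopAt_notMem_Icc hS h4 (by linarith)) (loopAt_notMem_Icc' hS h2 (by linarith)))
    (dKA' (loopAt_notMem_Icc' hS h3 (by linarith))
      (loopAt_notMem_Icc' hS (by linarith) (by linarith))).symm
    (disjoint_loopAt_Icc hS h3 (by linarith)).symm
    (disjoint_insert_loopAt hM (loopAt_notMem_Icc' hS (by linarith) (by linarith))).symm
    (disjoint_insert_loopAt hM (loopAt_notMem_Icc' hS (by linarith) (by linarith))).symm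
    (dK (hne le_rfl (by linarith) h5) (hne le_rfl h1 (by linarith)))
    (dK (hne (by linarith) h4 h5) (hne h1.le (by linarith) (by linarith)).symm)
    (disjoint_insert_loopAt hM (loopAt_notMem_Icc' hS (by linarith) (by linarith))).symm
    (disjoint_insert_loopAt hM (loopAt_notMem_Icc' hS (by linarith) (by linarith))).symm
    (dK' (hne h1.le h2 (by linarith)) (hne le_rfl h1 (by linarith)).symm)
    (dK' (hne (by linarith) h3 (by linarith)).symm (hne le_rfl (by linarith) (by linarith)).symm)
    (disjoint_insert_loopAt hM (loopAt_notMem_Icc' hS (by linarith) (by linarith))).symm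
    (disjoint_insert_loopAt hM (loopAt_notMem_Icc hS (by linarith) (by linarith))).symm
    (disjoint_insert_loopAt hM (loopAt_notMem_Icc' hS (by linarith) (by linarith))).symm
    (disjoint_insert_loopAt hM (loopAt_notMem_Icc' hS (by linarith) (by linarith))).symm

/-- Two bridges of a planar loop that are joined off the loop do not have three common points of
attachment. -/
theorem not_three_common {f : X → ℂ} (hf : Continuous f) (hinj : Function.Injective f)
    (hS : Function.Injective S) {C C' E : Set X} {v v' : X} (hC : Disjoint C (Set.range S))
    (hC' : Disjoint C' (Set.range S)) (hE : Disjoint E (Set.range S)) (hCC' : Disjoint C C')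
    (hv : JoinedIn E v v') {p q r : ℝ} (h1 : p < q) (h2 : q < r) (h3 : r < p + 1)
    (hp : JoinedIn (insert (loopAt S p) C) v (loopAt S p))
    (hq : JoinedIn (insert (loopAt S q) C) v (loopAt S q))
    (hr : JoinedIn (insert (loopAt S r) C) v (loopAt S r))
    (hp' : JoinedIn (insert (loopAt S p) C') v' (loopAt S p))
    (hq' : JoinedIn (insert (loopAt S q) C') v' (loopAt S q))
    (hr' : JoinedIn (insert (loopAt S r) C') v' (loopAt S r)) : False := by
  have hEs : ∀ A, Disjoint E (loopAt S '' A) := fun A =>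
    hE.mono_right (by rintro _ ⟨t, -, rfl⟩; exact loopAt_mem_range t)
  have n1 := loopAt_ne hS h1 (by linarith)
  have n2 := loopAt_ne hS h2 (by linarith)
  have n3 := loopAt_ne hS (h1.trans h2) h3
  have dd := fun {s t} => disjoint_insert_insert (p := s) (q := t) hC hC' hCC'
  have e1 : loopAt S p ∉ loopAt S '' Set.Icc q r := loopAt_notMem_Icc' hS h1 h3
  have e2 : loopAt S q ∉ loopAt S '' Set.Icc r (p + 1) := loopAt_notMem_Icc' hS h2 (by linarith)
  have e3 : loopAt S r ∉ loopAt S '' Set.Icc p q := loopAt_notMem_Icc hS h2 h3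
  -- The vertices v and v' are joined along E, and each is joined to p, q and r through its own
  -- bridge. The loop supplies the triangle on p, q, r.
  refine not_drawing_K5 hf hinj ![v, v', loopAt S p, loopAt S q, loopAt S r]
    ![![∅, E, insert (loopAt S p) C, insert (loopAt S q) C, insert (loopAt S r) C],
      ![∅, ∅, insert (loopAt S p) C', insert (loopAt S q) C', insert (loopAt S r) C'],
      ![∅, ∅, ∅, loopAt S '' Set.Icc p q, loopAt S '' Set.Icc r (p + 1)],
      ![∅, ∅, ∅, ∅, loopAt S '' Set.Icc q r], fun _ => ∅] ?_ ?_
  · have j1 := joinedIn_loopAt (S := S) h1.le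
    have j2 := joinedIn_loopAt (S := S) h2.le
    have j3 := (joinedIn_loopAt_turn (S := S) h3.le).symm
    intro i j hij
    fin_cases i <;> fin_cases j <;> first | exact absurd hij (by decide) | assumption
  · intro i j k l hij hkl hik hjk hjl
    fin_cases i <;> fin_cases j <;> first | exact absurd hij (by decide) | skip
    all_goals fin_cases k <;> first | exact absurd hik (by decide) | exact absurd rfl hjk | skip
    all_goals fin_cases l <;> first | exact absurd hkl (by decide) | exact absurd rfl hjl | skip
    · exact hEs _
    · exact hEs _
    · exact hEs _
    · exact dd n1
    · exact dd n3
    · exact disjoint_insert_loopAt hC e1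
    · exact dd n1.symm
    · exact dd n2
    · exact disjoint_insert_loopAt hC e2
    · exact dd n3.symm
    · exact dd n2.symm
    · exact disjoint_insert_loopAt hC e3
    · exact disjoint_insert_loopAt hC' e1
    · exact disjoint_insert_loopAt hC' e2
    · exact disjoint_insert_loopAt hC' e3

end Loop

/-! ### Rerouting fans -/

section Fan

variable {X : Type*} [TopologicalSpace X] {C L : Set X} {v z₀ z₁ x : X} {F₀ F₁ : Set X}

/-- Follow the leg F₀ from v to the point t where E arrives, then E back to x. Since E meets the fan
only at t, the result is an arc and still meets the other leg only in v. -/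
theorem IsArc.reroute (hCL : Disjoint C L) (hz₀ : z₀ ∈ L) (h₀ : IsArc F₀ v z₀)
    (s₀ : F₀ ⊆ insert z₀ C) (h₀₁ : F₀ ∩ F₁ ⊆ {v}) {t : X} {E : Set X} (hE : IsArc E x t)
    (sE : E ⊆ insert x C) (hEt : E ∩ (F₀ ∪ F₁) = {t}) (ht : t ∈ F₀) (htv : t ≠ v) (htC : t ∈ C) :
    ∃ G, IsArc G v x ∧ G ⊆ insert x C ∧ G ∩ F₁ ⊆ {v} := by
  have htz : t ≠ z₀ := by rintro rfl; exact Set.disjoint_left.1 hCL htC hz₀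
  obtain ⟨A, B, hA, hB, sA, sB, hAB⟩ := h₀.split ht htv htz
  refine ⟨A ∪ E, hA.trans hE.symm ?_, Set.union_subset (fun y hy => .inr ?_) sE, ?_⟩
  · exact fun y hy => hEt.subset ⟨hy.2, .inl (sA hy.1)⟩
  · refine (s₀ (sA hy)).resolve_left ?_
    rintro rfl
    exact htz (hAB.subset ⟨hy, hB.right_mem⟩).symm
  · rintro y ⟨hy | hy, hy'⟩
    · exact h₀₁ ⟨sA hy, hy'⟩
    · obtain rfl : y = t := hEt.subset ⟨hy, .inr hy'⟩
      exact h₀₁ ⟨ht, hy'⟩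

variable [T2Space X]

/-- Start at x towards v and stop at the first point of the fan. -/
theorem exists_first_hit_fan (hCL : Disjoint C L) (hv : v ∈ C) (h₀ : IsArc F₀ v z₀)
    (h₁ : IsArc F₁ v z₁) (s₀ : F₀ ⊆ insert z₀ C) (s₁ : F₁ ⊆ insert z₁ C) (hx : x ∈ L)
    (hx₀ : x ≠ z₀) (hx₁ : x ≠ z₁) (hvx : ArcJoined (insert x C) v x) :
    ∃ t E, IsArc E x t ∧ E ⊆ insert x C ∧ E ∩ (F₀ ∪ F₁) = {t} ∧ t ∈ C := by
  have hxC : x ∉ C := fun h => Set.disjoint_left.1 hCL h hx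
  obtain ⟨E, hE, hE'⟩ := hvx.symm.exists_isArc (by rintro rfl; exact hxC hv)
  have hxF : x ∉ F₀ ∪ F₁ := by
    rintro (h | h)
    · exact (s₀ h).elim hx₀ hxC
    · exact (s₁ h).elim hx₁ hxC
  obtain ⟨t, E', hs, h, ht⟩ := hE'.first_hit (h₀.isClosed.union h₁.isClosed) hxF
    (.inl h₀.left_mem)
  refine ⟨t, E', h, hs.trans hE, ht, (hE (hs h.right_mem)).resolve_left ?_⟩
  rintro rfl
  exact h.ne rfl

/-- One end can always be moved to x: the leg that the arc from x hits is rerouted and the other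
leg, ending at z, is kept. -/
theorem exists_fan_one (hCL : Disjoint C L) (hv : v ∈ C) (hz₀ : z₀ ∈ L) (hz₁ : z₁ ∈ L)
    (h₀ : IsArc F₀ v z₀) (h₁ : IsArc F₁ v z₁) (s₀ : F₀ ⊆ insert z₀ C) (s₁ : F₁ ⊆ insert z₁ C)
    (h₀₁ : F₀ ∩ F₁ ⊆ {v}) (hx : x ∈ L) (hvx : ArcJoined (insert x C) v x) :
    ∃ z G₀ G₁, (z = z₀ ∨ z = z₁) ∧ z ≠ x ∧ IsArc G₀ v x ∧ IsArc G₁ v z ∧ G₀ ⊆ insert x C ∧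
      G₁ ⊆ insert z C ∧ G₀ ∩ G₁ ⊆ {v} := by
  have hz : z₀ ≠ z₁ := by
    rintro rfl
    exact h₀.ne (h₀₁ ⟨h₀.right_mem, h₁.right_mem⟩).symm
  by_cases hx₀ : x = z₀
  · subst hx₀
    exact ⟨z₁, F₀, F₁, .inr rfl, hz.symm, h₀, h₁, s₀, s₁, h₀₁⟩
  by_cases hx₁ : x = z₁
  · subst hx₁
    exact ⟨z₀, F₁, F₀, .inl rfl, hz, h₁, h₀, s₁, s₀, by rwa [Set.inter_comm]⟩
  obtain ⟨t, E, hE, sE, hEt, htC⟩ := exists_first_hit_fan hCL hv h₀ h₁ s₀ s₁ hx hx₀ hx₁ hvx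
  by_cases htv : t = v
  · subst htv
    exact ⟨z₁, E, F₁, .inr rfl, Ne.symm hx₁, hE.symm, h₁, sE, s₁,
      (Set.inter_subset_inter_right _ Set.subset_union_right).trans hEt.subset⟩
  rcases (hEt.symm.subset rfl).2 with ht | ht
  · obtain ⟨G, hG, sG, hGF⟩ := IsArc.reroute hCL hz₀ h₀ s₀ h₀₁ hE sE hEt ht htv htC
    exact ⟨z₁, G, F₁, .inr rfl, Ne.symm hx₁, hG, h₁, sG, s₁, hGF⟩
  · obtain ⟨G, hG, sG, hGF⟩ := IsArc.reroute hCL hz₁ h₁ s₁ (by rwa [Set.inter_comm]) hE sE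
      (by rwa [Set.union_comm]) ht htv htC
    exact ⟨z₀, G, F₀, .inl rfl, Ne.symm hx₀, hG, h₀, sG, s₀, hGF⟩

/-- A fan from `v` to `L` can be rerouted to given points of attachment, unless this would create
a tripod that avoids one of the legs. -/
theorem exists_fan {x₀ x₁ : X} (hCL : Disjoint C L) (hv : v ∈ C) (hz₀ : z₀ ∈ L) (hz₁ : z₁ ∈ L)
    (h₀ : IsArc F₀ v z₀) (h₁ : IsArc F₁ v z₁) (s₀ : F₀ ⊆ insert z₀ C) (s₁ : F₁ ⊆ insert z₁ C)
    (h₀₁ : F₀ ∩ F₁ ⊆ {v}) (hx₀ : x₀ ∈ L) (hx₁ : x₁ ∈ L) (hne : x₀ ≠ x₁)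
    (hvx₀ : ArcJoined (insert x₀ C) v x₀) (hvx₁ : ArcJoined (insert x₁ C) v x₁)
    (hno : ∀ z w A B D G, z = z₀ ∨ z = z₁ → z ≠ x₀ → z ≠ x₁ → IsArc A w x₀ → IsArc B w x₁ →
      IsArc D w v → IsArc G v z → A ⊆ insert x₀ C → B ⊆ insert x₁ C → D ⊆ C → G ⊆ insert z C →
      v ∉ A → v ∉ B → Disjoint A G → Disjoint B G → False) :
    ∃ G₀ G₁, IsArc G₀ v x₀ ∧ IsArc G₁ v x₁ ∧ G₀ ⊆ insert x₀ C ∧ G₁ ⊆ insert x₁ C ∧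
      G₀ ∩ G₁ ⊆ {v} := by
  obtain ⟨z, F, G, hz, hzx, hF, hG, sF, sG, hFG⟩ :=
    exists_fan_one hCL hv hz₀ hz₁ h₀ h₁ s₀ s₁ h₀₁ hx₀ hvx₀
  have hzL : z ∈ L := by rcases hz with rfl | rfl <;> assumption
  by_cases hzx₁ : z = x₁
  · subst hzx₁
    exact ⟨F, G, hF, hG, sF, sG, hFG⟩
  obtain ⟨t, E, hE, sE, hEt, htC⟩ :=
    exists_first_hit_fan hCL hv hF hG sF sG hx₁ hne.symm (Ne.symm hzx₁) hvx₁
  by_cases htv : t = v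
  · subst htv
    refine ⟨F, E, hF, hE.symm, sF, sE, fun y hy => hEt.subset ⟨hy.2, .inl hy.1⟩⟩
  rcases (hEt.symm.subset rfl).2 with ht | ht
  -- The arc from x₁ hits the leg that already ends at x₀, so t is the centre of a tripod with ends
  -- x₀, x₁ and v. The remaining leg G avoids its branches to x₀ and x₁, which is the excluded
  -- configuration.
  · exfalso
    have htx : t ≠ x₀ := by rintro rfl; exact Set.disjoint_left.1 hCL htC hx₀
    obtain ⟨D, A, hD, hA, sD, sA, hDA⟩ := hF.split ht htv htx
    have hvA : v ∉ A := fun h => htv (hDA.subset ⟨hD.left_mem, h⟩).symm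
    refine hno z t A E D G hz hzx hzx₁ hA hE.symm hD.symm hG (sA.trans sF) sE (fun y hy => ?_) sG
      hvA (fun h => htv (hEt.subset ⟨h, .inl hF.left_mem⟩).symm) ?_ ?_
    · refine (sF (sD hy)).resolve_left ?_
      rintro rfl
      exact htx (hDA.subset ⟨hy, hA.right_mem⟩).symm
    · rw [Set.disjoint_left]
      intro y hyA hyG
      obtain rfl : y = v := hFG ⟨sA hyA, hyG⟩
      exact hvA hyA
    · rw [Set.disjoint_left]
      intro y hyE hyG
      obtain rfl : y = t := hEt.subset ⟨hyE, .inr hyG⟩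
      exact htv (hFG ⟨ht, hyG⟩)
  · obtain ⟨G', hG', sG', hGF⟩ := IsArc.reroute hCL hzL hG sG (by rwa [Set.inter_comm]) hE sE
      (by rwa [Set.union_comm]) ht htv htC
    exact ⟨F, G', hF, hG', sF, sG', by rwa [Set.inter_comm]⟩

end Fan

/-- The tripod with ends `a`, `b`, `v` and the path `z`, `v`, `v'` cannot lie on the same side of a
planar loop. -/
theorem not_tripod {X : Type*} [TopologicalSpace X] {S : C(AddCircle (1 : ℝ), X)} {f : X → ℂ}
    (hf : Continuous f) (hinj : Function.Injective f)
    (hS : Function.Injective S) {C C' E : Set X} {v v' : X} (hC : Disjoint C (Set.range S))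
    (hC' : Disjoint C' (Set.range S)) (hE : Disjoint E (Set.range S)) (hCC' : Disjoint C C')
    (hEC : E ∩ C ⊆ {v}) (hv : JoinedIn E v v') {a a' b' b z : ℝ} (h1 : a ≤ a') (h2 : a' < b')
    (h3 : b' ≤ b) (h4 : b < z) (h5 : z < a + 1)
    (ha' : JoinedIn (insert (loopAt S a') C') v' (loopAt S a'))
    (hb' : JoinedIn (insert (loopAt S b') C') v' (loopAt S b'))
    {w : X} {A B D G : Set X} (hA : JoinedIn A w (loopAt S a)) (hB : JoinedIn B w (loopAt S b))
    (hD : JoinedIn D w v) (hG : JoinedIn G v (loopAt S z)) (sA : A ⊆ insert (loopAt S a) C)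
    (sB : B ⊆ insert (loopAt S b) C) (sD : D ⊆ C) (sG : G ⊆ insert (loopAt S z) C) (hvA : v ∉ A)
    (hvB : v ∉ B) (hAG : Disjoint A G) (hBG : Disjoint B G) : False := by
  have hEs : ∀ A, Disjoint E (loopAt S '' A) := fun A =>
    hE.mono_right (by rintro _ ⟨t, -, rfl⟩; exact loopAt_mem_range t)
  have hCs : ∀ A, Disjoint C (loopAt S '' A) := fun A =>
    hC.mono_right (by rintro _ ⟨t, -, rfl⟩; exact loopAt_mem_range t)
  have hEI : ∀ {Q t}, Q ⊆ insert (loopAt S t) C → v ∉ Q → Disjoint Q E := by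
    intro Q t sQ hQ
    rw [Set.disjoint_left]
    intro y hy hyE
    rcases sQ hy with rfl | hyC
    · exact Set.disjoint_left.1 hE hyE (loopAt_mem_range _)
    · obtain rfl : y = v := hEC ⟨hyE, hyC⟩
      exact hQ hy
  have dC : ∀ {s}, Disjoint C (insert (loopAt S s) C') := fun {s} => by
    rw [Set.disjoint_insert_right]
    exact ⟨fun h => Set.disjoint_left.1 hC h (loopAt_mem_range _), hCC'⟩
  have dd := fun {s t} => disjoint_insert_insert (p := s) (q := t) hC hC' hCC'
  have n1 := disjoint_insert_loopAt hC (loopAt_notMem_Icc' hS (p := a) (s := b') (t := b)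
    (by linarith) (by linarith))
  have n2 := disjoint_insert_loopAt hC (loopAt_notMem_Icc hS (p := b) (s := a) (t := a')
    (by linarith) (by linarith))
  have n3 := disjoint_insert_loopAt hC (loopAt_notMem_Icc hS (p := z) (s := a) (t := a')
    (by linarith) (by linarith))
  have n4 := disjoint_insert_loopAt hC (loopAt_notMem_Icc hS (p := z) (s := b') (t := b)
    (by linarith) (by linarith))
  -- The parts are {w, z, v'} and {a, b, v}. From v' the points a and b are reached through C' to a'
  -- and b' and then along the loop, while z reaches a and b along the loop.
  refine not_drawing_K33_of_sets hf hinj (a0 := w) (a1 := loopAt S z) (a2 := v')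
    (b0 := loopAt S a) (b1 := loopAt S b) (b2 := v)
    (F20 := insert (loopAt S a') C' ∪ loopAt S '' Set.Icc a a')
    (F21 := insert (loopAt S b') C' ∪ loopAt S '' Set.Icc b' b)
    hA hB hD (joinedIn_loopAt_turn h5.le) (joinedIn_loopAt h4.le).symm hG.symm
    ((ha'.mono Set.subset_union_left).trans
      ((joinedIn_loopAt h1).symm.mono Set.subset_union_right))
    ((hb'.mono Set.subset_union_left).trans ((joinedIn_loopAt h3).mono Set.subset_union_right))
    hv.symm
    ((disjoint_insert_loopAt hC (loopAt_notMem_Icc' hS (by linarith) (by linarith))).mono_left sA)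
    hAG
    ((disjoint_insert_loopAt hC (loopAt_notMem_Icc' hS h4 (by linarith))).mono_left sB)
    hBG ((hCs _).mono_left sD) ((hCs _).mono_left sD)
    (Disjoint.mono_left sA (Set.disjoint_union_right.2
      ⟨dd (loopAt_ne hS (by linarith) (by linarith)), n1⟩))
    (hEI sA hvA)
    (Disjoint.mono_left sB (Set.disjoint_union_right.2
      ⟨dd (loopAt_ne hS (by linarith) (by linarith)).symm, n2⟩))
    (hEI sB hvB)
    (Disjoint.mono_left sD (Set.disjoint_union_right.2 ⟨dC, hCs _⟩))
    (Disjoint.mono_left sD (Set.disjoint_union_right.2 ⟨dC, hCs _⟩))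
    (Set.disjoint_union_right.2 ⟨(disjoint_insert_loopAt hC'
      (loopAt_notMem_Icc' hS (by linarith) (by linarith))).symm,
      (disjoint_loopAt_Icc hS (by linarith) (by linarith)).symm⟩)
    (hEs _).symm
    (Set.disjoint_union_right.2 ⟨(disjoint_insert_loopAt hC'
      (loopAt_notMem_Icc' hS (by linarith) (by linarith))).symm,
      (disjoint_loopAt_Icc hS (by linarith) (by linarith)).symm⟩)
    (hEs _).symm
    (Disjoint.mono_left sG (Set.disjoint_union_right.2
      ⟨dd (loopAt_ne hS (by linarith) (by linarith)).symm, n3⟩))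
    (Disjoint.mono_left sG (Set.disjoint_union_right.2
      ⟨dd (loopAt_ne hS (by linarith) (by linarith)).symm, n4⟩))

/-! ### Cyclic order of the points of attachment -/

theorem add_intCast_mem_of_periodic {P : Set ℝ} (hP : ∀ t, t + 1 ∈ P ↔ t ∈ P) {t : ℝ} (ht : t ∈ P)
    (n : ℤ) : t + n ∈ P := by
  induction n using Int.induction_on with
  | zero => simpa
  | succ n ih => rw [← hP] at ih; push_cast at *; rwa [← add_assoc]
  | pred n ih => rw [← hP]; push_cast at *; convert ih using 1; ring

theorem exists_mem_Ioc_of_periodic {P : Set ℝ} (hP : ∀ t, t + 1 ∈ P ↔ t ∈ P) {t : ℝ} (ht : t ∈ P)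
    (a : ℝ) : ∃ n : ℤ, t + n ∈ P ∧ t + n ∈ Set.Ioc a (a + 1) := by
  refine ⟨⌊a - t⌋ + 1, add_intCast_mem_of_periodic hP ht _, ?_, ?_⟩
  · push_cast; linarith [Int.lt_floor_add_one (a - t)]
  · push_cast; linarith [Int.floor_le (a - t)]

theorem exists_least_greatest {P : Set ℝ} (hf : ∀ a b, (P ∩ Set.Icc a b).Finite) {a b x : ℝ}
    (hx : x ∈ P) (hx' : x ∈ Set.Icc a b) : ∃ m M, (m ∈ P ∧ m ∈ Set.Icc a b) ∧
      (M ∈ P ∧ M ∈ Set.Icc a b) ∧ ∀ y ∈ P, y ∈ Set.Icc a b → m ≤ y ∧ y ≤ M := by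
  obtain ⟨m, hm, hm'⟩ := Set.exists_min_image _ id (hf a b) ⟨x, hx, hx'⟩
  obtain ⟨M, hM, hM'⟩ := Set.exists_max_image _ id (hf a b) ⟨x, hx, hx'⟩
  exact ⟨m, M, hm, hM, fun y hy hy' => ⟨hm' y ⟨hy, hy'⟩, hM' y ⟨hy, hy'⟩⟩⟩

/-- `P` and `P'` do not cross on the circle. -/
def NoncrossingOn (P P' : Set ℝ) : Prop :=
  ∀ p ∈ P, ∀ p' ∈ P', ∀ q ∈ P, ∀ q' ∈ P', p < p' → p' < q → q < q' → q' < p + 1 → False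

/-- Let X and M be the extreme points of P in [y₁, y₀ + 1]. If no point of P' lies strictly between
them, the cut (M - 1, X) works. If some d in P' does, noncrossing forces y₀ = M - 1 and y₁ = X. A
further point of P in (X, M) would then cross, or equal d and be a third common point; so the cut
(X, M) works. -/
theorem exists_separating_of_empty {P P' : Set ℝ} (hP : ∀ t, t + 1 ∈ P ↔ t ∈ P)
    (hP' : ∀ t, t + 1 ∈ P' ↔ t ∈ P') (hf : ∀ a b, (P ∩ Set.Icc a b).Finite)
    (hnc : NoncrossingOn P P')
    (h5 : ∀ p q r, p < q → q < r → r < p + 1 → p ∈ P → q ∈ P → r ∈ P → p ∈ P' → q ∈ P' → r ∈ P' →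
      False)
    {x₀ x₁ y₀ y₁ : ℝ} (hx₀ : x₀ ∈ P) (hx₁ : x₁ ∈ P) (hy₀ : y₀ ∈ P') (hy₁ : y₁ ∈ P')
    (h1 : x₀ ≤ y₀) (h2 : y₀ < y₁) (h3 : y₁ ≤ x₁) (h4 : x₁ < x₀ + 1)
    (hemp : ∀ t ∈ P, t ∉ Set.Ioo y₀ y₁) :
    ∃ a b, a < b ∧ b < a + 1 ∧ (∀ t ∈ P, t ∉ Set.Ioo a b) ∧ ∀ t ∈ P', t ∉ Set.Ioo b (a + 1) := by
  obtain ⟨X, M, ⟨hX, hX1, hX2⟩, ⟨hM, hM1, hM2⟩, hmM⟩ :=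
    exists_least_greatest hf (a := y₁) (b := y₀ + 1) hx₁ ⟨h3, by linarith⟩
  have hXx := (hmM x₁ hx₁ ⟨h3, by linarith⟩).1
  have hMx := (hmM (x₀ + 1) ((hP _).2 hx₀) ⟨by linarith, by linarith⟩).2
  have hM0 : M - 1 ∈ P := by rw [← hP]; simpa
  have hy₀' := (hP' _).2 hy₀
  have hy₁' := (hP' _).2 hy₁
  by_cases hd : ∃ d ∈ P', X < d ∧ d < M
  · obtain ⟨d, hd, hXd, hdM⟩ := hd
    have e0 : y₀ = M - 1 := by
      by_contra hne
      have : M < y₀ + 1 := hM2.lt_of_ne (by rintro h; exact hne (by linarith))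
      exact hnc X hX d hd M hM (y₀ + 1) hy₀' hXd hdM this (by linarith)
    have e1 : y₁ = X := by
      by_contra hne
      have : y₁ < X := hX1.lt_of_ne hne
      exact hnc X hX d hd M hM (y₁ + 1) hy₁' hXd hdM (by linarith) (by linarith)
    refine ⟨X, M, by linarith, by linarith, ?_, ?_⟩
    · rintro c hc ⟨hc1, hc2⟩
      rcases lt_trichotomy c d with h | rfl | h
      · exact hnc c hc d hd M hM (y₁ + 1) hy₁' h hdM (by linarith) (by linarith)
      · exact h5 (M - 1) X c (by linarith) hXd (by linarith) hM0 hX hc (e0 ▸ hy₀) (e1 ▸ hy₁) hd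
      · exact hnc X hX d hd c hc (y₀ + 1) hy₀' hXd h (by linarith) (by linarith)
    · rintro t ht ⟨ht1, ht2⟩
      have ht' : t - 1 ∈ P' := by rw [← hP']; simpa
      exact hnc (M - 1) hM0 (t - 1) ht' X hX d hd (by linarith) (by linarith) hXd (by linarith)
  · push Not at hd
    refine ⟨M - 1, X, by linarith, by linarith, ?_, ?_⟩
    · rintro t ht ⟨ht1, ht2⟩
      rcases le_or_gt t y₀ with h | h
      · have := (hmM (t + 1) ((hP _).2 ht) ⟨by linarith, by linarith⟩).2
        linarith
      · rcases lt_or_ge t y₁ with h' | h'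
        · exact hemp t ht ⟨h, h'⟩
        · have := (hmM t ht ⟨h', by linarith⟩).1
          linarith
    · rintro t ht ⟨ht1, ht2⟩
      have := hd t ht ht1
      linarith

/-- Once the circle is cut into an arc containing P' and an arc containing P, the extreme points of
the two sets on these arcs are as required. -/
theorem exists_extremal {P P' : Set ℝ} (hP : ∀ t, t + 1 ∈ P ↔ t ∈ P)
    (hP' : ∀ t, t + 1 ∈ P' ↔ t ∈ P') (hf : ∀ a b, (P ∩ Set.Icc a b).Finite)
    (hf' : ∀ a b, (P' ∩ Set.Icc a b).Finite) (hnc : NoncrossingOn P P')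
    (h5 : ∀ p q r, p < q → q < r → r < p + 1 → p ∈ P → q ∈ P → r ∈ P → p ∈ P' → q ∈ P' → r ∈ P' →
      False)
    {x₀ x₁ y₀ y₁ : ℝ} (hx₀ : x₀ ∈ P) (hx₁ : x₁ ∈ P) (hy₀ : y₀ ∈ P') (hy₁ : y₁ ∈ P')
    (h1 : x₀ ≤ y₀) (h2 : y₀ < y₁) (h3 : y₁ ≤ x₁) (h4 : x₁ < x₀ + 1) :
    ∃ X₀ Y₀ Y₁ X₁, X₀ ∈ P ∧ X₁ ∈ P ∧ Y₀ ∈ P' ∧ Y₁ ∈ P' ∧ X₀ ≤ Y₀ ∧ Y₀ < Y₁ ∧ Y₁ ≤ X₁ ∧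
      X₁ < X₀ + 1 ∧ (∀ t ∈ P, t ∉ Set.Ioo X₀ X₁) ∧ ∀ t ∈ P', t ∉ Set.Ioo Y₁ (Y₀ + 1) := by
  obtain ⟨a, b, hab, hba, hPe, hPe'⟩ : ∃ a b, a < b ∧ b < a + 1 ∧ (∀ t ∈ P, t ∉ Set.Ioo a b) ∧
      ∀ t ∈ P', t ∉ Set.Ioo b (a + 1) := by
    by_cases hc : ∃ c ∈ P, y₀ < c ∧ c < y₁
    · obtain ⟨c, hc, hc1, hc2⟩ := hc
      have e0 : x₀ = y₀ := by
        by_contra hne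
        exact hnc x₀ hx₀ y₀ hy₀ c hc y₁ hy₁ (h1.lt_of_ne hne) hc1 hc2 (by linarith)
      have e1 : y₁ = x₁ := by
        by_contra hne
        exact hnc c hc y₁ hy₁ x₁ hx₁ (y₀ + 1) ((hP' _).2 hy₀) hc2 (h3.lt_of_ne hne) (by linarith)
          (by linarith)
      -- A point of P in (y₀, y₁) forces x₀ = y₀ and x₁ = y₁ and empties the complementary arc of P.
      -- The lemma applies after rotating the four points.
      refine exists_separating_of_empty hP hP' hf hnc h5 hx₁ ((hP _).2 hx₀) hy₁ ((hP' _).2 hy₀)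
        e1.ge (by linarith) (by linarith) (by linarith) ?_
      rintro d hd ⟨hd1, hd2⟩
      exact hnc c hc y₁ hy₁ d hd (y₀ + 1) ((hP' _).2 hy₀) hc2 hd1 hd2 (by linarith)
    · push Not at hc
      exact exists_separating_of_empty hP hP' hf hnc h5 hx₀ hx₁ hy₀ hy₁ h1 h2 h3 h4
        fun t ht h => (hc t ht h.1).not_gt h.2
  have key : ∀ t ∈ P, ∃ n : ℤ, t + n ∈ P ∧ t + n ∈ Set.Icc b (a + 1) := by
    intro t ht
    obtain ⟨n, hn, hn1, hn2⟩ := exists_mem_Ioc_of_periodic hP ht a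
    exact ⟨n, hn, le_of_not_gt fun h => hPe _ hn ⟨hn1, h⟩, hn2⟩
  have key' : ∀ t ∈ P', ∃ n : ℤ, t + n ∈ P' ∧ t + n ∈ Set.Icc a b := by
    intro t ht
    obtain ⟨n, hn, hn1, hn2⟩ := exists_mem_Ioc_of_periodic hP' ht (b - 1)
    refine ⟨n, hn, le_of_not_gt fun h => hPe' _ ((hP' _).2 hn) ⟨?_, ?_⟩, ?_⟩ <;> linarith
  have distinct : ∀ {s t : ℝ}, s < t → t < s + 1 → ∀ m n : ℤ, s + m ≠ t + n := by
    intro s t hst hts m n h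
    have e1 : (0 : ℝ) < m - n := by linarith
    have e2 : (m - n : ℝ) < 1 := by linarith
    have e1' : 0 < m - n := by exact_mod_cast e1
    have e2' : m - n < 1 := by exact_mod_cast e2
    omega
  obtain ⟨m₀, hm₀, hm₀'⟩ := key x₀ hx₀
  obtain ⟨m₁, hm₁, hm₁'⟩ := key x₁ hx₁
  obtain ⟨n₀, hn₀, hn₀'⟩ := key' y₀ hy₀
  obtain ⟨n₁, hn₁, hn₁'⟩ := key' y₁ hy₁
  obtain ⟨X, M, ⟨hX, hX1, hX2⟩, ⟨hM, hM1, hM2⟩, hmM⟩ := exists_least_greatest hf hm₀ hm₀'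
  obtain ⟨Y, N, ⟨hY, hY1, hY2⟩, ⟨hN, hN1, hN2⟩, hyN⟩ := exists_least_greatest hf' hn₀ hn₀'
  -- The given points are distinct modulo 1, so each set has two different extreme points; this
  -- yields Y₀ < Y₁ and X₁ < X₀ + 1.
  have dx := distinct (by linarith : x₀ < x₁) h4 m₀ m₁
  have dy := distinct h2 (by linarith : y₁ < y₀ + 1) n₀ n₁
  have hXM : X < M := by
    have a1 := hmM _ hm₀ hm₀'
    have a2 := hmM _ hm₁ hm₁'
    by_contra h
    exact dx (by linarith)
  have hYN : Y < N := by
    have a1 := hyN _ hn₀ hn₀'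
    have a2 := hyN _ hn₁ hn₁'
    by_contra h
    exact dy (by linarith)
  have hM0 : M - 1 ∈ P := by rw [← hP]; simpa
  refine ⟨M - 1, Y, N, X, hM0, hX, hY, hN, by linarith, hYN, by linarith, by linarith, ?_, ?_⟩
  · rintro t ht ⟨ht1, ht2⟩
    rcases le_or_gt t a with h | h
    · have := (hmM (t + 1) ((hP _).2 ht) ⟨by linarith, by linarith⟩).2
      linarith
    · rcases lt_or_ge t b with h' | h'
      · exact hPe t ht ⟨h, h'⟩
      · have := (hmM t ht ⟨h', by linarith⟩).1
        linarith
  · rintro t ht ⟨ht1, ht2⟩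
    rcases le_or_gt t b with h | h
    · have := (hyN t ht ⟨by linarith, h⟩).2
      linarith
    · rcases lt_or_ge t (a + 1) with h' | h'
      · exact hPe' t ht ⟨h, h'⟩
      · have ht' : t - 1 ∈ P' := by rw [← hP']; simpa
        have := (hyN (t - 1) ht' ⟨by linarith, by linarith⟩).1
        linarith

/-- Bridges that cross each of four pairs of points on a circle cannot avoid a special point and
be noncrossing at the same time. -/
theorem bridges_contradiction {ι : Type*} {Q : ι → ℝ → Prop} (hQ : ∀ k t, Q k (t + 1) ↔ Q k t)
    {M : ℝ → Prop} (hM : ∀ t, M (t + 1) ↔ M t) {X₀ X₁ Y₀ Y₁ : ℝ} (h1 : X₀ ≤ Y₀) (h2 : Y₀ < Y₁)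
    (h3 : Y₁ ≤ X₁) (h4 : X₁ < X₀ + 1) (m1 : M X₀) (m2 : M X₁) (m3 : M Y₀) (m4 : M Y₁)
    (hbr : ∀ p q, p = X₀ ∨ p = Y₀ → q = X₁ ∨ q = Y₁ → ∃ k, ∃ s ∈ Set.Ioo p q,
      ∃ t ∈ Set.Ioo q (p + 1), Q k s ∧ Q k t)
    (hns : ∀ k p q, p = X₀ ∨ p = Y₀ → q = X₁ ∨ q = Y₁ → ∀ s ∈ Set.Ioo p q,
      ∀ t ∈ Set.Ioo q (p + 1), Q k s → Q k t → s = Y₀ ∨ s = Y₁ ∨ t = X₁ ∨ t = X₀ + 1)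
    (hcr : ∀ k k' x y b z a, k ≠ k' → x < y → y < b → b < z → z < a → a < x + 1 → M x → M y → M z →
      Q k a → Q k y → Q k' b → Q k' x → False) : False := by
  have m1' := (hM _).2 m1
  have m3' := (hM _).2 m3
  -- The outer pair gives a bridge whose foot a is strictly between X₁ and X₀ + 1, hence not
  -- special; its other foot s must then be Y₀ or Y₁. Dually, the inner pair gives a foot b strictly
  -- between Y₀ and Y₁ and a foot t at X₁ or X₀ + 1.
  obtain ⟨k₁, s, ⟨hs1, hs2⟩, a, ⟨ha1, ha2⟩, hk₁s, hk₁a⟩ := hbr X₀ X₁ (.inl rfl) (.inl rfl)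
  obtain ⟨k₂, b, ⟨hb1, hb2⟩, t, ⟨ht1, ht2⟩, hk₂b, hk₂t⟩ := hbr Y₀ Y₁ (.inr rfl) (.inr rfl)
  have hs : s = Y₀ ∨ s = Y₁ := by
    rcases hns k₁ X₀ X₁ (.inl rfl) (.inl rfl) s ⟨hs1, hs2⟩ a ⟨ha1, ha2⟩ hk₁s hk₁a with
      h | h | h | h
    · exact .inl h
    · exact .inr h
    · exact absurd h ha1.ne'
    · exact absurd h ha2.ne
  have ht : t = X₁ ∨ t = X₀ + 1 := by
    rcases hns k₂ Y₀ Y₁ (.inr rfl) (.inr rfl) b ⟨hb1, hb2⟩ t ⟨ht1, ht2⟩ hk₂b hk₂t with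
      h | h | h | h
    · exact absurd h hb1.ne'
    · exact absurd h hb2.ne
    · exact .inl h
    · exact .inr h
  have noab : ∀ k, Q k a → Q k b → False := by
    intro k ha hb
    rcases hns k X₀ X₁ (.inl rfl) (.inl rfl) b ⟨by linarith, by linarith⟩ a ⟨ha1, ha2⟩ hb ha with
      h | h | h | h <;> linarith
  have hk : k₁ ≠ k₂ := by
    rintro rfl
    exact noab k₁ hk₁a hk₂b
  have hQ' : ∀ {k u}, Q k u → Q k (u + 1) := fun h => (hQ _ _).2 h
  have c00 : ∀ k k', Q k a → Q k Y₀ → Q k' b → Q k' X₀ → X₀ < Y₀ → False := by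
    intro k k' e1 e2 e3 e4 hlt
    exact hcr k k' X₀ Y₀ b Y₁ a (by rintro rfl; exact noab k e1 e3) hlt hb1 hb2 (by linarith) ha2
      m1 m3 m4 e1 e2 e3 e4
  have c11 : ∀ k k', Q k a → Q k Y₁ → Q k' b → Q k' X₁ → Y₁ < X₁ → False := by
    intro k k' e1 e2 e3 e4 hlt
    exact hcr k' k Y₁ X₁ a (Y₀ + 1) (b + 1) (by rintro rfl; exact noab _ e1 e3) hlt ha1
      (by linarith) (by linarith) (by linarith) m4 m2 m3' (hQ' e3) e4 e1 e2
  -- If s and t have the same index, the two bridges are excluded by `c00` or `c11`. In the two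
  -- mixed cases a third bridge, over the pair Y₀, X₁ or X₀, Y₁, overlaps k₁ or k₂ in the forbidden
  -- way.
  rcases hs with rfl | rfl <;> rcases ht with rfl | rfl
  · obtain ⟨k₃, p, ⟨hp1, hp2⟩, q, ⟨hq1, hq2⟩, hp, hq⟩ := hbr s t (.inr rfl) (.inl rfl)
    have c1 : p = Y₁ → False := by
      rintro rfl
      by_cases hk : k₂ = k₃
      · subst hk
        rcases hns k₂ s t (.inr rfl) (.inl rfl) b ⟨hb1, by linarith⟩ q ⟨hq1, hq2⟩ hk₂b hq with
          h | h | h | h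
        · linarith
        · linarith
        · linarith
        · subst h
          exact c00 k₁ k₂ hk₁a hk₁s hk₂b ((hQ _ _).1 hq) hs1
      · exact hcr k₂ k₃ p t q (s + 1) (b + 1) hk ht1 hq1 hq2 (by linarith) (by linarith) m4 m2
          m3' (hQ' hk₂b) hk₂t hq hp
    rcases hns k₃ s t (.inr rfl) (.inl rfl) p ⟨hp1, hp2⟩ q ⟨hq1, hq2⟩ hp hq with h | h | h | h
    · linarith
    · exact c1 h
    · linarith
    · subst h
      have hq' := (hQ _ _).1 hq
      by_cases hk : k₁ = k₃
      · subst hk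
        rcases hns k₁ s t (.inr rfl) (.inl rfl) p ⟨hp1, hp2⟩ a ⟨ha1, by linarith⟩ hp hk₁a with
          h | h | h | h
        · linarith
        · exact c1 h
        · linarith
        · linarith
      · exact hcr k₁ k₃ X₀ s p t a hk hs1 hp1 hp2 ha1 ha2 m1 m3 m2 hk₁a hk₁s hp hq'
  · exact c00 k₁ k₂ hk₁a hk₁s hk₂b ((hQ _ _).1 hk₂t) hs1
  · exact c11 k₁ k₂ hk₁a hk₁s hk₂b hk₂t ht1
  · have hk₂t' := (hQ _ _).1 hk₂t
    obtain ⟨k₃, p, ⟨hp1, hp2⟩, q, ⟨hq1, hq2⟩, hp, hq⟩ := hbr X₀ s (.inl rfl) (.inr rfl)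
    have c1 : p = Y₀ → False := by
      rintro rfl
      by_cases hk : k₃ = k₂
      · subst hk
        rcases hns k₃ X₀ s (.inl rfl) (.inr rfl) b ⟨by linarith, hb2⟩ q ⟨hq1, hq2⟩ hk₂b hq with
          h | h | h | h
        · linarith
        · linarith
        · subst h
          exact c11 k₁ k₃ hk₁a hk₁s hk₂b hq hs2
        · linarith
      · exact hcr k₃ k₂ X₀ p b s q hk hp1 hb1 hb2 hq1 hq2 m1 m3 m4 hq hp hk₂b hk₂t'
    rcases hns k₃ X₀ s (.inl rfl) (.inr rfl) p ⟨hp1, hp2⟩ q ⟨hq1, hq2⟩ hp hq with h | h | h | h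
    · exact c1 h
    · linarith
    · subst h
      by_cases hk : k₃ = k₁
      · subst hk
        rcases hns k₃ X₀ s (.inl rfl) (.inr rfl) p ⟨hp1, hp2⟩ a ⟨by linarith, ha2⟩ hp hk₁a with
          h | h | h | h
        · exact c1 h
        · linarith
        · linarith
        · linarith
      · exact hcr k₃ k₁ s q a (X₀ + 1) (p + 1) hk hq1 ha1 ha2 (by linarith) (by linarith) m4 m2
          m1' (hQ' hp) hq hk₁a hk₁s
    · linarith

/-! ### Angelic graphs -/

/-- Each point of the arc other than p is joined to v by an initial piece that does not reach p and
so stays in Z. -/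
theorem IsArc.subset_insert_component {X : Type*} [TopologicalSpace X] {F Z : Set X} {v p : X}
    (h : IsArc F v p) (hF : F ⊆ insert p Z) : F ⊆ insert p (connectedComponentIn Z v) := by
  have hv : v ∈ Z := (hF h.left_mem).resolve_left h.ne
  intro w hw
  by_cases hwp : w = p
  · exact .inl hwp
  by_cases hwv : w = v
  · rw [hwv]
    exact .inr (mem_connectedComponentIn hv)
  obtain ⟨A, B, hA, hB, sA, -, hAB⟩ := h.split hw hwv hwp
  refine .inr (hA.joinedIn fun y hy => (hF (sA hy)).resolve_left ?_).mem_connectedComponentIn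
  rintro rfl
  exact hwp (hAB.subset ⟨hy, hB.right_mem⟩).symm

theorem finite_loopAt_preimage_inter {X : Type*} [TopologicalSpace X]
    {S : C(AddCircle (1 : ℝ), X)} (hS : Function.Injective S) {T : Set X} (hT : T.Finite)
    (a b : ℝ) : (loopAt S ⁻¹' T ∩ Set.Icc a b).Finite := by
  have : loopAt S ⁻¹' T ∩ Set.Icc a b = ⋃ x ∈ T, (loopAt S ⁻¹' {x} ∩ Set.Icc a b) := by
    ext
    simp only [Set.mem_inter_iff, Set.mem_preimage, Set.mem_iUnion, Set.mem_singleton_iff,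
      exists_prop]
    constructor
    · exact fun h => ⟨_, h.1, rfl, h.2⟩
    · rintro ⟨_, h, rfl, h'⟩
      exact ⟨h, h'⟩
  rw [this]
  refine hT.biUnion fun x _ => ?_
  by_cases hx : x ∈ Set.range S
  · obtain ⟨t, -, -, rfl⟩ := exists_loopAt_eq hx a
    refine ((Set.finite_Icc ⌊a - t⌋ ⌈b - t⌉).image fun n : ℤ => t + n).subset ?_
    rintro s ⟨hs, h1, h2⟩
    obtain ⟨n, rfl⟩ := (loopAt_eq_iff hS).1 (Eq.symm hs)
    refine ⟨n, ⟨?_, ?_⟩, rfl⟩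
    · exact Int.floor_le_iff.2 (by linarith)
    · exact Int.le_ceil_iff.2 (by linarith)
  · convert Set.finite_empty
    ext s
    simp only [Set.mem_inter_iff, Set.mem_preimage, Set.mem_singleton_iff, Set.mem_empty_iff_false,
      iff_false, not_and]
    rintro rfl
    exact absurd (loopAt_mem_range s) hx

theorem loopAt_ne_of_mem_Ico {X : Type*} [TopologicalSpace X]
    {S : C(AddCircle (1 : ℝ), X)} (hS : Function.Injective S) {a s t : ℝ} (hs : a ≤ s)
    (hs' : s < a + 1) (ht : a ≤ t) (ht' : t < a + 1) (h : s ≠ t) : loopAt S s ≠ loopAt S t := by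
  rcases lt_or_gt_of_ne h with h | h
  · exact loopAt_ne hS h (by linarith)
  · exact (loopAt_ne hS h (by linarith)).symm

theorem disjoint_connectedComponentIn {X : Type*} [TopologicalSpace X] {Z : Set X} {p q : X}
    (h : connectedComponentIn Z p ≠ connectedComponentIn Z q) :
    Disjoint (connectedComponentIn Z p) (connectedComponentIn Z q) := by
  rw [Set.disjoint_left]
  intro x hp hq
  exact h ((connectedComponentIn_eq hp).trans (connectedComponentIn_eq hq).symm)

namespace AngelicGraph

variable {X : Type*} [TopologicalSpace X] (A : AngelicGraph X)

/-- The complement of the open edge and of the loop. -/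
def rest : Set X := {p | p ∉ A.openEdge} \ Set.range A.S

theorem e_zero_mem : A.e 0 ∈ A.rest := by
  refine ⟨?_, ?_⟩
  · rintro ⟨t, ht, h⟩
    exact ht.1.ne' (A.e_injective h)
  · rintro ⟨t, h⟩
    exact A.e_S _ _ h.symm

theorem e_one_mem : A.e 1 ∈ A.rest := by
  refine ⟨?_, ?_⟩
  · rintro ⟨t, ht, h⟩
    exact ht.2.ne (A.e_injective h)
  · rintro ⟨t, h⟩
    exact A.e_S _ _ h.symm

theorem range_S_subset : Set.range A.S ⊆ {p | p ∉ A.openEdge} := by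
  rintro _ ⟨t, rfl⟩ ⟨s, -, h⟩
  exact A.e_S _ _ h

theorem isArc_α (i : Fin 2) : IsArc (Set.range (A.α i)) (A.e 0) (loopAt A.S (A.x i)) := by
  have := IsArc.of_continuousMap (A.α_injective i)
  rwa [A.α_source, A.α_target] at this

theorem isArc_β (i : Fin 2) : IsArc (Set.range (A.β i)) (A.e 1) (loopAt A.S (A.y i)) := by
  have := (IsArc.of_continuousMap (A.β_injective i)).symm
  rwa [A.β_source, A.β_target] at this

theorem range_α_subset (i : Fin 2) : Set.range (A.α i) ⊆
    insert (loopAt A.S (A.x i)) (connectedComponentIn A.rest (A.e 0)) := by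
  refine (A.isArc_α i).subset_insert_component ?_
  rintro _ ⟨s, rfl⟩
  by_cases hs : s = 1
  · exact .inl (hs ▸ A.α_target i)
  refine .inr ⟨?_, ?_⟩
  · rintro ⟨t, ht, h⟩
    obtain rfl := A.α_e i s t h.symm
    rw [A.α_source] at h
    exact ht.1.ne' (A.e_injective h)
  · rintro ⟨t, h⟩
    exact hs (A.α_S i s t h.symm)

theorem range_β_subset (i : Fin 2) : Set.range (A.β i) ⊆
    insert (loopAt A.S (A.y i)) (connectedComponentIn A.rest (A.e 1)) := by
  refine (A.isArc_β i).subset_insert_component ?_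
  rintro _ ⟨s, rfl⟩
  by_cases hs : s = 0
  · exact .inl (hs ▸ A.β_source i)
  refine .inr ⟨?_, ?_⟩
  · rintro ⟨t, ht, h⟩
    obtain rfl := A.β_e i s t h.symm
    rw [A.β_target] at h
    exact ht.2.ne (A.e_injective h)
  · rintro ⟨t, h⟩
    exact hs (A.β_S i s t h.symm)

theorem range_α_inter : Set.range (A.α 0) ∩ Set.range (A.α 1) ⊆ {A.e 0} := by
  rintro _ ⟨⟨s, rfl⟩, t, h⟩
  obtain ⟨rfl, rfl⟩ := A.α_α s t h.symm
  exact A.α_source 0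

theorem range_β_inter : Set.range (A.β 0) ∩ Set.range (A.β 1) ⊆ {A.e 1} := by
  rintro _ ⟨⟨s, rfl⟩, t, h⟩
  obtain ⟨rfl, rfl⟩ := A.β_β s t h.symm
  exact A.β_target 0

theorem attaches_α (i : Fin 2) :
    Attaches (connectedComponentIn A.rest (A.e 0)) (loopAt A.S (A.x i)) :=
  ⟨_, mem_connectedComponentIn A.e_zero_mem,
    .inr ⟨_, A.range_α_subset i, (A.isArc_α i).symm⟩⟩

theorem attaches_β (i : Fin 2) :
    Attaches (connectedComponentIn A.rest (A.e 1)) (loopAt A.S (A.y i)) :=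
  ⟨_, mem_connectedComponentIn A.e_one_mem,
    .inr ⟨_, A.range_β_subset i, (A.isArc_β i).symm⟩⟩

theorem range_e_subset : Set.range A.e ⊆ A.openEdge ∪ {A.e 0, A.e 1} := by
  rintro _ ⟨t, rfl⟩
  rcases eq_or_ne t 0 with rfl | h0
  · simp
  rcases eq_or_ne t 1 with rfl | h1
  · simp
  exact .inl ⟨t, ⟨unitInterval.pos_iff_ne_zero.2 h0, unitInterval.lt_one_iff_ne_one.2 h1⟩, rfl⟩

theorem joinedIn_e : JoinedIn (Set.range A.e) (A.e 0) (A.e 1) :=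
  (IsArc.of_continuousMap A.e_injective).joinedIn subset_rfl

theorem disjoint_component_loop (z : X) :
    Disjoint (connectedComponentIn A.rest z) (Set.range A.S) :=
  Set.disjoint_left.2 fun _ h => (connectedComponentIn_subset _ _ h).2

theorem disjoint_e_loop : Disjoint (Set.range A.e) (Set.range A.S) := by
  rw [Set.disjoint_left]
  rintro _ ⟨s, rfl⟩ ⟨t, h⟩
  exact A.e_S s t h.symm

theorem mem_of_e_of_component {z y : X} (h : y ∈ Set.range A.e)
    (hy : y ∈ connectedComponentIn A.rest z) : y = A.e 0 ∨ y = A.e 1 := by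
  rcases A.range_e_subset h with h | h
  · exact absurd h (connectedComponentIn_subset _ _ hy).1
  · exact h

/-- An angel with the same edge and loop, given by new legs. -/
theorem exists_of_fans (hsep : A.e 1 ∉ connectedComponentIn A.rest (A.e 0)) {x y : Fin 2 → ℝ}
    (h1 : x 0 ≤ y 0) (h2 : y 0 < y 1) (h3 : y 1 ≤ x 1) (h4 : x 1 < x 0 + 1) {F G : Fin 2 → Set X}
    (hF : ∀ i, IsArc (F i) (A.e 0) (loopAt A.S (x i)))
    (hG : ∀ i, IsArc (G i) (A.e 1) (loopAt A.S (y i)))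
    (sF : ∀ i, F i ⊆ insert (loopAt A.S (x i)) (connectedComponentIn A.rest (A.e 0)))
    (sG : ∀ i, G i ⊆ insert (loopAt A.S (y i)) (connectedComponentIn A.rest (A.e 1)))
    (dF : F 0 ∩ F 1 ⊆ {A.e 0}) (dG : G 0 ∩ G 1 ⊆ {A.e 1}) :
    ∃ B : AngelicGraph X, B.e = A.e ∧ B.S = A.S ∧ B.x = x ∧ B.y = y ∧
      (∀ i, Set.range (B.α i) = F i) ∧ ∀ i, Set.range (B.β i) = G i := by
  have dC := disjoint_connectedComponentIn (Z := A.rest) (p := A.e 0) (q := A.e 1) fun h =>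
    hsep (h ▸ mem_connectedComponentIn A.e_one_mem)
  have m0 := mem_connectedComponentIn A.e_zero_mem
  have m1 := mem_connectedComponentIn A.e_one_mem
  have dL0 := A.disjoint_component_loop (A.e 0)
  have dL1 := A.disjoint_component_loop (A.e 1)
  choose α hα hα0 hα1 hαF using fun i => (hF i).exists_continuousMap
  choose β hβ hβ0 hβ1 hβG using fun i => (hG i).symm.exists_continuousMap
  have mα : ∀ i s, α i s ∈ insert (loopAt A.S (x i)) (connectedComponentIn A.rest (A.e 0)) :=
    fun i s => sF i (hαF i ▸ ⟨s, rfl⟩)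
  have mβ : ∀ i s, β i s ∈ insert (loopAt A.S (y i)) (connectedComponentIn A.rest (A.e 1)) :=
    fun i s => sG i (hβG i ▸ ⟨s, rfl⟩)
  refine ⟨{ e := A.e, S := A.S, x := x, y := y, α := α, β := β, order_zero := h1, order_mid := h2,
            order_one := h3, order_turn := h4, e_injective := A.e_injective,
            S_injective := A.S_injective, α_injective := hα, β_injective := hβ, α_source := hα0,
            α_target := hα1, β_source := hβ0, β_target := hβ1, e_S := A.e_S, α_e := ?_, β_e := ?_,
            α_S := ?_, β_S := ?_, α_α := ?_, β_β := ?_, α_β := ?_ }, rfl, rfl, rfl, rfl, hαF, hβG⟩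
  · intro i s t h
    rcases mα i s with h' | h'
    · exact absurd (h.symm.trans h') (A.e_S _ _)
    · rcases A.mem_of_e_of_component ⟨t, h.symm⟩ h' with h'' | h''
      · exact hα i (h''.trans (hα0 i).symm)
      · exact absurd (h'' ▸ h') hsep
  · intro i s t h
    rcases mβ i s with h' | h'
    · exact absurd (h.symm.trans h') (A.e_S _ _)
    · rcases A.mem_of_e_of_component ⟨t, h.symm⟩ h' with h'' | h''
      · exact absurd (h'' ▸ h') (Set.disjoint_left.1 dC m0)
      · exact hβ i (h''.trans (hβ1 i).symm)
  · intro i s t h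
    rcases mα i s with h' | h'
    · exact hα i (h'.trans (hα1 i).symm)
    · exact absurd ⟨t, h.symm⟩ (Set.disjoint_left.1 dL0 h')
  · intro i s t h
    rcases mβ i s with h' | h'
    · exact hβ i (h'.trans (hβ0 i).symm)
    · exact absurd ⟨t, h.symm⟩ (Set.disjoint_left.1 dL1 h')
  · intro s t h
    have h' : α 0 s = A.e 0 := dF ⟨hαF 0 ▸ ⟨s, rfl⟩, hαF 1 ▸ ⟨t, h.symm⟩⟩
    exact ⟨hα 0 (h'.trans (hα0 0).symm), hα 1 ((h.symm.trans h').trans (hα0 1).symm)⟩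
  · intro s t h
    have h' : β 0 s = A.e 1 := dG ⟨hβG 0 ▸ ⟨s, rfl⟩, hβG 1 ▸ ⟨t, h.symm⟩⟩
    exact ⟨hβ 0 (h'.trans (hβ1 0).symm), hβ 1 ((h.symm.trans h').trans (hβ1 1).symm)⟩
  · intro i j s t h
    rcases mα i s with h' | h'
    · refine ⟨hα i (h'.trans (hα1 i).symm), ?_⟩
      rcases mβ j t with h'' | h''
      · exact hβ j (h''.trans (hβ0 j).symm)
      · exact absurd (loopAt_mem_range _) (Set.disjoint_left.1 dL1 ((h.symm.trans h') ▸ h''))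
    · exfalso
      rcases mβ j t with h'' | h''
      · exact Set.disjoint_left.1 dL0 h' ((h.trans h'') ▸ loopAt_mem_range _)
      · exact Set.disjoint_left.1 dC h' (h ▸ h'')

/-- A component of the complement of the angel attached on both sides of two of its special points
splits the angel. -/
theorem isSplit_of_attaches [T2Space X] {A : AngelicGraph X} {K : Set X} (hK : ∀ y ∈ K, y ∉ A.support)
    (hKc : ∀ p q, p ∈ K → q ∈ K → ArcJoined K p q) {s t p q : ℝ} (h1 : p < s) (h2 : s < q)
    (h3 : q < t) (h4 : t < p + 1) (hs : (s : AddCircle (1 : ℝ)) ∈ A.loopComplement)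
    (ht : (t : AddCircle (1 : ℝ)) ∈ A.loopComplement)
    (hp : (p : AddCircle (1 : ℝ)) ∉ A.loopComplement)
    (hq : (q : AddCircle (1 : ℝ)) ∉ A.loopComplement) (hKs : Attaches K (loopAt A.S s))
    (hKt : Attaches K (loopAt A.S t)) : A.IsSplit := by
  obtain ⟨a, ha, hsa⟩ := hKs
  obtain ⟨b, hb, htb⟩ := hKt
  have hj : ArcJoined (insert (loopAt A.S s) (insert (loopAt A.S t) K)) (loopAt A.S s)
      (loopAt A.S t) :=
    (hsa.mono (Set.insert_subset_insert (Set.subset_insert _ _))).trans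
      (((hKc a b ha hb).mono ((Set.subset_insert _ _).trans (Set.subset_insert _ _))).trans
        (htb.symm.mono (Set.subset_insert _ _)))
  obtain ⟨F, sF, hF⟩ := hj.exists_isArc (loopAt_ne A.S_injective (h2.trans h3) (by linarith))
  obtain ⟨d, hd, hd0, hd1, hdF⟩ := hF.exists_continuousMap
  refine ⟨d, s, t, hd, hd0, hd1, hs, ht, fun hcon => ?_, fun r hr0 hr1 => ?_⟩
  · have hJ := (isPreconnected_connectedComponentIn (F := A.loopComplement)
      (x := (s : AddCircle (1 : ℝ)))).image A.S A.S.continuous.continuousOn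
    have hnot : ∀ u : ℝ, (u : AddCircle (1 : ℝ)) ∉ A.loopComplement → loopAt A.S u ∉
        A.S '' connectedComponentIn A.loopComplement (s : AddCircle (1 : ℝ)) := by
      rintro u hu ⟨w, hw, h⟩
      exact hu (A.S_injective h ▸ connectedComponentIn_subset _ _ hw)
    exact not_both_sides_of_isPreconnected A.S_injective hJ (Set.image_subset_range _ _)
      (hnot p hp) (hnot q hq) ⟨_, mem_connectedComponentIn hs, rfl⟩ ⟨_, hcon, rfl⟩
      ⟨s, ⟨h1, h2⟩, rfl⟩ ⟨t, ⟨h3, h4⟩, rfl⟩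
  · rcases sF (hdF ▸ ⟨r, rfl⟩ : d r ∈ F) with h | h | h
    · exact absurd (hd (h.trans hd0.symm)) hr0
    · exact absurd (hd (h.trans hd1.symm)) hr1
    · exact hK _ h

end AngelicGraph

/-! ### Extremal legs and the splitting bridge -/

theorem IsPlanarSpace.exists_complex {X : Type*} [TopologicalSpace X] (h : IsPlanarSpace X) :
    ∃ f : X → ℂ, Continuous f ∧ Function.Injective f := by
  obtain ⟨f, hf⟩ := h
  refine ⟨fun x => (f x 0 : ℂ) + (f x 1 : ℂ) * Complex.I, ?_, fun x y hxy => hf.injective ?_⟩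
  · have := hf.continuous
    fun_prop
  · have h0 := congr_arg Complex.re hxy
    have h1 := congr_arg Complex.im hxy
    simp at h0 h1
    ext i
    fin_cases i
    · exact h0
    · exact h1

namespace AngelicGraph

variable {X : Type*} [TopologicalSpace X] [T2Space X] {A : AngelicGraph X}

theorem exists_isSplit_of_chart {W : Type*} [Finite W] {H : SimpleGraph W}
    (c : GraphChart {p | p ∉ A.openEdge} H)
    (h3 : ∀ x y : W, x ≠ y → HasDisjointPaths H 3 x y) {f : X → ℂ} (hf : Continuous f)
    (hinj : Function.Injective f) (hsep : A.e 1 ∉ connectedComponentIn A.rest (A.e 0)) :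
    ∃ B : AngelicGraph X, A.Equivalent B ∧ B.IsSplit := by
  have hS := A.S_injective
  have hSY := A.range_S_subset
  have hL : c.Saturates (Set.range A.S) := fun u w h => c.inner_subset_or_disjoint hS hSY h
  have hLc : IsClosed (Set.range A.S) := (isCompact_range A.S.continuous).isClosed
  let K : X → Set X := connectedComponentIn A.rest
  have hKeq : ∀ {y x}, x ∈ K y → K y = K x := fun h => connectedComponentIn_eq h
  have m0 : A.e 0 ∈ K (A.e 0) := mem_connectedComponentIn A.e_zero_mem
  have m1 : A.e 1 ∈ K (A.e 1) := mem_connectedComponentIn A.e_one_mem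
  have hne : K (A.e 0) ≠ K (A.e 1) := fun h => hsep (by change _ ∈ K (A.e 0); rwa [h])
  have dC : Disjoint (K (A.e 0)) (K (A.e 1)) := disjoint_connectedComponentIn hne
  have dL : ∀ z, Disjoint (K z) (Set.range A.S) := A.disjoint_component_loop
  have hE := A.disjoint_e_loop
  have hEC : Set.range A.e ∩ K (A.e 0) ⊆ {A.e 0} := fun y hy =>
    (A.mem_of_e_of_component hy.1 hy.2).resolve_right fun h => hsep (h ▸ hy.2)
  have hEC' : Set.range A.e ∩ K (A.e 1) ⊆ {A.e 1} := fun y hy =>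
    (A.mem_of_e_of_component hy.1 hy.2).resolve_left fun h =>
      Set.disjoint_left.1 dC m0 (h ▸ hy.2)
  have hatt : ∀ {z p q}, Attaches (K z) p → q ∈ K z → ArcJoined (insert p (K z)) p q :=
    fun h hq => hL.attaches hLc h hq
  have hat0 : ∀ {t}, Attaches (K (A.e 0)) (loopAt A.S t) →
      ArcJoined (insert (loopAt A.S t) (K (A.e 0))) (A.e 0) (loopAt A.S t) :=
    fun h => (hatt h m0).symm
  have hat1 : ∀ {t}, Attaches (K (A.e 1)) (loopAt A.S t) →
      ArcJoined (insert (loopAt A.S t) (K (A.e 1))) (A.e 1) (loopAt A.S t) :=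
    fun h => (hatt h m1).symm
  have hvert : ∀ {z t}, Attaches (K z) (loopAt A.S t) → ∃ u, c.vert u = loopAt A.S t :=
    fun h => hL.exists_vert h (loopAt_mem_range _) (hSY (loopAt_mem_range _))
  let P : X → Set ℝ := fun z => {t | Attaches (K z) (loopAt A.S t)}
  have hper : ∀ z t, t + 1 ∈ P z ↔ t ∈ P z := fun z t => by
    simp only [P, Set.mem_ofPred_eq, loopAt_add_one]
  have hfin : ∀ z a b, (P z ∩ Set.Icc a b).Finite := by
    intro z a b
    refine (finite_loopAt_preimage_inter hS (Set.finite_range c.vert) a b).subset ?_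
    exact fun t ht => ⟨hvert ht.1, ht.2⟩
  have hnc : NoncrossingOn (P (A.e 0)) (P (A.e 1)) :=
    fun p hp p' hp' q hq q' hq' a1 a2 a3 a4 =>
      not_crossing_of_joinedIn hf hinj hS (dL _) (dL _) hE dC A.joinedIn_e a1 a2 a3 a4
        (hat0 hp).joinedIn (hat0 hq).joinedIn (hat1 hp').joinedIn (hat1 hq').joinedIn
  obtain ⟨X₀, Y₀, Y₁, X₁, hX₀, hX₁, hY₀, hY₁, o1, o2, o3, o4, hPe, hPe'⟩ :=
    exists_extremal (hper (A.e 0)) (hper (A.e 1)) (hfin _) (hfin _) hnc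
      (fun p q r a1 a2 a3 hp hq hr hp' hq' hr' =>
        not_three_common hf hinj hS (dL _) (dL _) hE dC A.joinedIn_e a1 a2 a3
          (hat0 hp).joinedIn (hat0 hq).joinedIn (hat0 hr).joinedIn (hat1 hp').joinedIn
          (hat1 hq').joinedIn (hat1 hr').joinedIn)
      (A.attaches_α 0) (A.attaches_α 1) (A.attaches_β 0) (A.attaches_β 1) A.order_zero A.order_mid
      A.order_one A.order_turn
  obtain ⟨F₀, F₁, hF₀, hF₁, sF₀, sF₁, dF⟩ := exists_fan (x₀ := loopAt A.S X₀)
    (x₁ := loopAt A.S X₁) (dL (A.e 0)) m0 (loopAt_mem_range _)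
    (loopAt_mem_range _) (A.isArc_α 0) (A.isArc_α 1) (A.range_α_subset 0) (A.range_α_subset 1)
    A.range_α_inter (loopAt_mem_range _) (loopAt_mem_range _)
    (loopAt_ne hS (by linarith) (by linarith)) (hat0 hX₀) (hat0 hX₁) (by
      intro z w T B D G hz hz0 hz1 hT hB hD hG sT sB sD sG hvT hvB hTG hBG
      have hzP : Attaches (K (A.e 0)) z := by
        rcases hz with rfl | rfl
        · exact A.attaches_α 0
        · exact A.attaches_α 1
      obtain ⟨t, t1, t2, rfl⟩ := exists_loopAt_eq (S := A.S) (x := z)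
        (by rcases hz with rfl | rfl <;> exact loopAt_mem_range _) X₀
      have t1' : X₀ < t := t1.lt_of_ne (by rintro rfl; exact hz0 rfl)
      -- A kept leg that ends elsewhere must end beyond X₁, since v's component has no foot strictly
      -- between X₀ and X₁. Then Y₀ and Y₁ lie on the arc from X₀ to X₁ opposite to it, as
      -- `not_tripod` requires.
      have t3 : X₁ < t := lt_of_not_ge fun h =>
        hPe t hzP ⟨t1', h.lt_of_ne (by rintro rfl; exact hz1 rfl)⟩
      exact not_tripod hf hinj hS (dL _) (dL _) hE dC hEC A.joinedIn_e o1 o2 o3 t3 t2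
        (hat1 hY₀).joinedIn (hat1 hY₁).joinedIn (hT.joinedIn subset_rfl) (hB.joinedIn subset_rfl)
        (hD.joinedIn subset_rfl) (hG.joinedIn subset_rfl) sT sB sD sG hvT hvB hTG hBG)
  -- The mirror argument for v': the loop is read from Y₁ to Y₀ + 1, an arc that contains X₁ and X₀
  -- + 1.
  obtain ⟨G₁, G₀, hG₁, hG₀, sG₁, sG₀, dG⟩ := exists_fan (x₀ := loopAt A.S Y₁)
    (x₁ := loopAt A.S Y₀) (dL (A.e 1)) m1 (loopAt_mem_range _)
    (loopAt_mem_range _) (A.isArc_β 0) (A.isArc_β 1) (A.range_β_subset 0) (A.range_β_subset 1)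
    A.range_β_inter (loopAt_mem_range _) (loopAt_mem_range _)
    (loopAt_ne hS o2 (by linarith)).symm (hat1 hY₁) (hat1 hY₀) (by
      intro z w T B D G hz hz0 hz1 hT hB hD hG sT sB sD sG hvT hvB hTG hBG
      have hzP : Attaches (K (A.e 1)) z := by
        rcases hz with rfl | rfl
        · exact A.attaches_β 0
        · exact A.attaches_β 1
      obtain ⟨t, t1, t2, rfl⟩ := exists_loopAt_eq (S := A.S) (x := z)
        (by rcases hz with rfl | rfl <;> exact loopAt_mem_range _) Y₁
      have t1' : Y₁ < t := t1.lt_of_ne (by rintro rfl; exact hz0 rfl)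
      have t3 : Y₀ + 1 < t := lt_of_not_ge fun h =>
        hPe' t hzP ⟨t1', h.lt_of_ne (by rintro rfl; exact hz1 (loopAt_add_one _))⟩
      rw [← loopAt_add_one Y₀] at hB sB
      exact not_tripod (a' := X₁) (b' := X₀ + 1) hf hinj hS (dL _) (dL _) hE dC.symm hEC'
        A.joinedIn_e.symm o3 o4 (by linarith) t3 t2
        (hat0 hX₁).joinedIn (hat0 ((hper _ _).2 hX₀)).joinedIn (hT.joinedIn subset_rfl)
        (hB.joinedIn subset_rfl)
        (hD.joinedIn subset_rfl) (hG.joinedIn subset_rfl) sT sB sD sG hvT hvB hTG hBG)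
  obtain ⟨B, hBe, hBS, hBx, hBy, hBα, hBβ⟩ := A.exists_of_fans hsep (x := ![X₀, X₁])
    (y := ![Y₀, Y₁]) (F := ![F₀, F₁]) (G := ![G₀, G₁]) o1 o2 o3 o4
    (Fin.forall_fin_two.2 ⟨hF₀, hF₁⟩) (Fin.forall_fin_two.2 ⟨hG₀, hG₁⟩)
    (Fin.forall_fin_two.2 ⟨sF₀, sF₁⟩) (Fin.forall_fin_two.2 ⟨sG₀, sG₁⟩) dF
    (by rw [Set.inter_comm]; exact dG)
  refine ⟨B, ⟨hBe.symm, hBS.symm⟩, ?_⟩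
  by_contra hnot
  -- The two components joined along e act as one bridge, attached at all four special points.
  let M : Set X := K (A.e 0) ∪ Set.range A.e ∪ K (A.e 1)
  have hML : Disjoint M (Set.range A.S) :=
    Set.disjoint_union_left.2 ⟨Set.disjoint_union_left.2 ⟨dL _, hE⟩, dL _⟩
  have hj1 : JoinedIn M (A.e 0) (A.e 1) :=
    A.joinedIn_e.mono fun y hy => .inl (.inr hy)
  have hKM : ∀ {z}, K z ≠ K (A.e 0) → K z ≠ K (A.e 1) → Disjoint M (K z) := by
    intro z h0 h1
    refine Set.disjoint_union_left.2 ⟨Set.disjoint_union_left.2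
      ⟨disjoint_connectedComponentIn h0.symm, ?_⟩, disjoint_connectedComponentIn h1.symm⟩
    rw [Set.disjoint_left]
    intro y hy hyK
    rcases A.mem_of_e_of_component hy hyK with rfl | rfl
    · exact h0 (hKeq hyK)
    · exact h1 (hKeq hyK)
  have hsupp : B.support ⊆ M ∪ Set.range A.S := by
    rintro y (((hy | hy) | hy) | hy)
    · exact .inl (.inl (.inr (hBe ▸ hy)))
    · exact .inr (hBS ▸ hy)
    · obtain ⟨i, hy⟩ := Set.mem_iUnion.1 hy
      rw [hBα] at hy
      have : y ∈ insert (loopAt A.S (![X₀, X₁] i)) (K (A.e 0)) :=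
        (Fin.forall_fin_two.2 ⟨sF₀, sF₁⟩ :
          ∀ i, ![F₀, F₁] i ⊆ insert (loopAt A.S (![X₀, X₁] i)) (K (A.e 0))) i hy
      rcases this with rfl | h
      · exact .inr (loopAt_mem_range _)
      · exact .inl (.inl (.inl h))
    · obtain ⟨i, hy⟩ := Set.mem_iUnion.1 hy
      rw [hBβ] at hy
      have : y ∈ insert (loopAt A.S (![Y₀, Y₁] i)) (K (A.e 1)) :=
        (Fin.forall_fin_two.2 ⟨sG₀, sG₁⟩ :
          ∀ i, ![G₀, G₁] i ⊆ insert (loopAt A.S (![Y₀, Y₁] i)) (K (A.e 1))) i hy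
      rcases this with rfl | h
      · exact .inr (loopAt_mem_range _)
      · exact .inl (.inr h)
  have hcomp : ∀ t : ℝ, (t : AddCircle (1 : ℝ)) ∈ B.loopComplement ↔
      loopAt A.S t ≠ loopAt A.S X₀ ∧ loopAt A.S t ≠ loopAt A.S X₁ ∧
      loopAt A.S t ≠ loopAt A.S Y₀ ∧ loopAt A.S t ≠ loopAt A.S Y₁ := by
    intro t
    simp only [loopComplement, hBx, hBy, Set.mem_ofPred_eq, Fin.forall_fin_two, loopAt, hS.ne_iff]
    simp only [Matrix.cons_val_zero, Matrix.cons_val_one]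
    tauto
  -- The index set consists of the remaining components, which are disjoint from M and hence from
  -- the new angel.
  refine bridges_contradiction
    (ι := {k : Set X // ∃ z ∈ A.rest, K z = k ∧ k ≠ K (A.e 0) ∧ k ≠ K (A.e 1)})
    (Q := fun k t => Attaches k.1 (loopAt A.S t)) (fun k t => by rw [loopAt_add_one])
    (M := fun t => JoinedIn (insert (loopAt A.S t) M) (A.e 0) (loopAt A.S t))
    (fun t => by rw [loopAt_add_one]) o1 o2 o3 o4 ?_ ?_ ?_ ?_ ?_ ?_ ?_
  · exact (hat0 hX₀).joinedIn.mono (Set.insert_subset_insert fun y hy => .inl (.inl hy))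
  · exact (hat0 hX₁).joinedIn.mono (Set.insert_subset_insert fun y hy => .inl (.inl hy))
  · exact (hj1.mono (Set.subset_insert _ _)).trans
      ((hat1 hY₀).joinedIn.mono (Set.insert_subset_insert fun y hy => .inr hy))
  · exact (hj1.mono (Set.subset_insert _ _)).trans
      ((hat1 hY₁).joinedIn.mono (Set.insert_subset_insert fun y hy => .inr hy))
  · intro p q hp hq
    obtain ⟨up, hup⟩ : ∃ u, c.vert u = loopAt A.S p := by
      rcases hp with rfl | rfl
      exacts [hvert hX₀, hvert hY₀]
    obtain ⟨uq, huq⟩ : ∃ u, c.vert u = loopAt A.S q := by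
      rcases hq with rfl | rfl
      exacts [hvert hX₁, hvert hY₁]
    have p1 : X₀ ≤ p := by rcases hp with rfl | rfl <;> linarith
    have p2 : p ≤ Y₀ := by rcases hp with rfl | rfl <;> linarith
    have q1 : Y₁ ≤ q := by rcases hq with rfl | rfl <;> linarith
    have q2 : q ≤ X₁ := by rcases hq with rfl | rfl <;> linarith
    have hC : ∀ t ∈ Set.Ioo p q, ¬ Attaches (K (A.e 0)) (loopAt A.S t) :=
      fun t ht h => hPe t h ⟨p1.trans_lt ht.1, ht.2.trans_le q2⟩
    have hC' : ∀ t ∈ Set.Ioo q (p + 1), ¬ Attaches (K (A.e 1)) (loopAt A.S t) :=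
      fun t ht h => hPe' t h ⟨q1.trans_lt ht.1, by linarith [ht.2]⟩
    obtain ⟨z, hz, s, hs, t, ht, hzs, hzt⟩ := c.exists_bridge hS hSY h3 (by linarith)
      (by linarith) hup huq A.e_zero_mem A.e_one_mem hC hC' hsep
    -- The bridge has a foot in (p, q), where v's component has none, and one in (q, p + 1), where
    -- that of v' has none; so it is neither of the two.
    refine ⟨⟨K z, z, hz, rfl, fun h => hC s hs ?_, fun h => hC' t ht ?_⟩, s, hs, t, ht, hzs, hzt⟩
    · rw [← h]; exact hzs
    · rw [← h]; exact hzt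
  · rintro ⟨_, z, hz, rfl, hz0, hz1⟩ p q hp hq s ⟨hs1, hs2⟩ t ⟨ht1, ht2⟩ hzs hzt
    -- As s is strictly between X₀ and X₁, only Y₀ and Y₁ could make it special; as t is strictly
    -- between Y₁ and Y₀ + 1, only X₁ and X₀ + 1 could. If neither occurs, the bridge splits the
    -- angel.
    by_contra! hcon
    obtain ⟨c1, c2, c3, c4⟩ := hcon
    have p1 : X₀ ≤ p := by rcases hp with rfl | rfl <;> linarith
    have p2 : p ≤ Y₀ := by rcases hp with rfl | rfl <;> linarith
    have q1 : Y₁ ≤ q := by rcases hq with rfl | rfl <;> linarith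
    have q2 : q ≤ X₁ := by rcases hq with rfl | rfl <;> linarith
    have ne := fun {a s t} => loopAt_ne_of_mem_Ico hS (a := a) (s := s) (t := t)
    refine hnot (isSplit_of_attaches (K := K z) (p := p) (q := q) (s := s) (t := t)
      (fun y hy hyB => ?_) (fun x y hx hy => hL.arcJoined hLc hx hy) hs1 hs2 ht1 ht2 ?_ ?_ ?_ ?_
      (hBS ▸ hzs) (hBS ▸ hzt))
    · rcases hsupp hyB with h | h
      · exact Set.disjoint_left.1 (hKM hz0 hz1) h hy
      · exact Set.disjoint_left.1 (dL z) hy h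
    · rw [hcomp]
      refine ⟨ne (a := X₀) ?_ ?_ ?_ ?_ ?_, ne (a := X₀) ?_ ?_ ?_ ?_ ?_, ne (a := X₀) ?_ ?_ ?_ ?_ c1,
        ne (a := X₀) ?_ ?_ ?_ ?_ c2⟩ <;> linarith
    · rw [hcomp, ← loopAt_add_one X₀, ← loopAt_add_one Y₀]
      refine ⟨ne (a := Y₁) ?_ ?_ ?_ ?_ c4, ne (a := Y₁) ?_ ?_ ?_ ?_ c3, ne (a := Y₁) ?_ ?_ ?_ ?_ ?_,
        ne (a := Y₁) ?_ ?_ ?_ ?_ ?_⟩ <;> linarith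
    · rw [hcomp]
      rcases hp with rfl | rfl <;> tauto
    · rw [hcomp]
      rcases hq with rfl | rfl <;> tauto
  · rintro ⟨_, z, hz, rfl, hz0, hz1⟩ ⟨_, z', hz', rfl, hz0', hz1'⟩ x y b w a hzz a1 a2 a3 a4 a5 hx hy hw hza hzy
      hzb hzx
    have hKK : K z ≠ K z' := fun h => hzz (Subtype.ext h)
    exact not_three_bridges hf hinj hS hML (dL z) (dL z') (hKM hz0 hz1) (hKM hz0' hz1')
      (disjoint_connectedComponentIn hKK) a1 a2 a3 a4 a5 hx hy hw
      (((hatt hza (mem_connectedComponentIn hz)).joinedIn.mono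
        (Set.insert_subset_insert (Set.subset_insert _ _))).trans
        ((hatt hzy (mem_connectedComponentIn hz)).symm.joinedIn.mono (Set.subset_insert _ _)))
      (((hatt hzb (mem_connectedComponentIn hz')).joinedIn.mono
        (Set.insert_subset_insert (Set.subset_insert _ _))).trans
        ((hatt hzx (mem_connectedComponentIn hz')).symm.joinedIn.mono (Set.subset_insert _ _)))

end AngelicGraph

theorem proposition7p4 {X : Type*} [TopologicalSpace X] [T2Space X]
    [Topology.CWComplex (Set.univ : Set X)] [Topology.CWComplex.Finite (Set.univ : Set X)]
    (hdim : ∀ n : ℕ, 2 ≤ n → IsEmpty (Topology.RelCWComplex.cell (Set.univ : Set X) n))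
    (A : AngelicGraph X)
    (hplanar : IsPlanarSpace X)
    (hconn : IsTopKConnected 3 {p : X // p ∉ A.openEdge})
    (hsep : A.v' ∉ connectedComponentIn {p : X | p ∉ A.openEdge ∧ p ∉ A.loop} A.v) :
    ∃ B : AngelicGraph X, A.Equivalent B ∧ B.IsSplit := by
  obtain ⟨f, hf, hinj⟩ := hplanar.exists_complex
  obtain ⟨n, H, ⟨⟨h⟩, -⟩, -, h3⟩ := hconn
  obtain ⟨c⟩ := exists_graphChart (Y := {p | p ∉ A.openEdge}) h (A.e 0)
  exact AngelicGraph.exists_isSplit_of_chart c h3 hf hinj hsep
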